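/- Let $w>\mu>0$ and, for $L\ge 2$, consider diffusion-limited pair annihilation and deposition on the torus $\mathbb T_L=\mathbb Z/L\mathbb Z$ together with its activity: the continuous-time Markov chain $(\eta(t),A(t))$ on $\{0,1\}^{\mathbb T_L}\times\mathbb N_0$ with generator $$(\tilde{\mathcal H}f)(\eta,A)=\sum_{k=0}^{L-1}\Big[\mu f(\bar\eta^{k,k+1},A)+w(\eta_k+\eta_{k+1})f(\bar\eta^{k,k+1},A+1)-\big(\mu+w(\eta_k+\eta_{k+1})\big)f(\eta,A)\Big],$$ where $\bar\eta^{k,k+1}$ is $\eta$ with the occupation numbers at $k$ and $k+1$ flipped. For every $s<0$ and every initial configuration $\eta$ with an even number of particles, the limit $$K_L(s)=\lim_{t\to\infty}\frac{1}{Lt}\ln \mathbb E_{\eta,0}\big[e^{sA(t)}\big]$$ exists and does not depend on $\eta$. The function $K_L$ is analytic at the critical point $s_c=\ln(1-\mu/w)<0$. Let $\kappa^c_n(L)=K_L^{(n)}(s_c)$ be the critical cumulants and put $\nu=1-\mu/w\in(0,1)$. (a) For every $k\ge1$, $|\kappa^c_{2k}(L)|\to\infty$ and $|\kappa^c_{2k+1}(L)|\to\infty$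 as $L\to\infty$, and both are of the same order in $L$: $\kappa^c_{2k+1}(L)=\Theta(\kappa^c_{2k}(L))$. (b) For every $n\ge3$, $$\lim_{L\to\infty}L^{2-n}\kappa^c_n(L)=\begin{cases}0,& n\text{ odd},\\ 2w\,\kappa^*_n,& n\text{ even},\end{cases}$$ where for $m\ge2$ $$\kappa^*_{2m}=(2m)!\;\frac{(1-2^{1-2m})\,\zeta(2m-1)}{\pi^{2m-1}}\;\frac{\nu^{2m}\binom{1/2}{m}}{(1-\nu^2)^{m-1/2}} .$$ In particular, in the normalization $w=1/2$ the limit for even $n$ is $\kappa^*_n$. -/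

import Mathlib

open Filter Topology Asymptotics
open scoped ENNReal

noncomputable section

namespace DLPAD

/-- Configurations on the discrete torus `ℤ/Lℤ`; `true` means that the site is occupied. -/
abbrev Config (L : ℕ) : Type := ZMod L → Bool

/-- The occupation number `η_k ∈ {0,1}`. -/
def occ {L : ℕ} (η : Config L) (k : ZMod L) : ℝ := if η k then 1 else 0

/-- The configuration with the occupation numbers at the sites `k` and `k+1` flipped. -/
def flip {L : ℕ} (k : ZMod L) (η : Config L) : Config L :=
  fun j => if j = k ∨ j = k + 1 then !(η j) else η j

/-- The total rate `μ + w (η_k + η_{k+1})` of the transition at the bond `(k, k+1)`. -/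
def rate (w μ : ℝ) {L : ℕ} (η : Config L) (k : ZMod L) : ℝ :=
  μ + w * (occ η k + occ η (k + 1))

/-- Number of particles of a configuration. -/
def particleNumber {L : ℕ} (η : Config L) : ℕ := Set.ncard {k | η k = true}

/-- The empty configuration (it lies in the even sector). -/
def emptyConfig (L : ℕ) : Config L := fun _ => false

/-- State space of the joint process (configuration, activity). -/
abbrev JointState (L : ℕ) : Type := Config L × ℕ

/-- Bounded real functions on the joint state space, with the supremum norm. -/
abbrev BddFun (L : ℕ) : Type := lp (fun _ : JointState L => ℝ) ∞

/-- The generator of the joint process acting on functions: at each bond `(k, k+1)` the pair of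
sites is flipped with rate `μ` (activity unchanged) and with rate `w (η_k + η_{k+1})` (activity
increased by one). -/
def jointGenFun (w μ : ℝ) (L : ℕ) (f : JointState L → ℝ) (x : JointState L) : ℝ :=
  ∑ k ∈ Finset.range L,
    (μ * f (flip (k : ZMod L) x.1, x.2)
      + w * (occ x.1 (k : ZMod L) + occ x.1 ((k : ZMod L) + 1))
          * f (flip (k : ZMod L) x.1, x.2 + 1)
      - rate w μ x.1 (k : ZMod L) * f x)

theorem abs_occ_le_one {L : ℕ} (η : Config L) (k : ZMod L) : |occ η k| ≤ 1 := by
  unfold occ; split <;> simp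

theorem abs_jointGenFun_le (w μ : ℝ) (L : ℕ) (f : JointState L → ℝ) (C : ℝ)
    (hf : ∀ x, |f x| ≤ C) (x : JointState L) :
    |jointGenFun w μ L f x| ≤ (L * (2 * |μ| + 4 * |w|)) * C := by
  have hC : 0 ≤ C := (abs_nonneg _).trans (hf x)
  have key : ∀ k ∈ Finset.range L,
      |μ * f (flip (k : ZMod L) x.1, x.2)
      + w * (occ x.1 (k : ZMod L) + occ x.1 ((k : ZMod L) + 1))
          * f (flip (k : ZMod L) x.1, x.2 + 1)
      - rate w μ x.1 (k : ZMod L) * f x| ≤ (2 * |μ| + 4 * |w|) * C := by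
    intro k _
    set o := occ x.1 (k : ZMod L) + occ x.1 ((k : ZMod L) + 1) with ho
    have h2 : |o| ≤ 2 := by
      have h := abs_add_le (occ x.1 (k : ZMod L)) (occ x.1 ((k : ZMod L) + 1))
      have h1 := abs_occ_le_one x.1 (k : ZMod L)
      have h3 := abs_occ_le_one x.1 ((k : ZMod L) + 1)
      linarith
    have hwo : |w * o| ≤ 2 * |w| := by
      rw [abs_mul]; nlinarith [abs_nonneg w]
    have hr : |rate w μ x.1 (k : ZMod L)| ≤ |μ| + 2 * |w| := by
      unfold rate; exact (abs_add_le _ _).trans (by linarith)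
    have e1 : |μ * f (flip (k : ZMod L) x.1, x.2)| ≤ |μ| * C := by
      rw [abs_mul]; gcongr; exact hf _
    have e2 : |w * o * f (flip (k : ZMod L) x.1, x.2 + 1)| ≤ (2 * |w|) * C := by
      rw [abs_mul]; gcongr; exact hf _
    have e3 : |rate w μ x.1 (k : ZMod L) * f x| ≤ (|μ| + 2 * |w|) * C := by
      rw [abs_mul]; gcongr; exact hf _
    refine (abs_sub _ _).trans ?_
    have e4 := abs_add_le (μ * f (flip (k : ZMod L) x.1, x.2))
      (w * o * f (flip (k : ZMod L) x.1, x.2 + 1))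
    linarith
  refine (Finset.abs_sum_le_sum_abs _ _).trans ((Finset.sum_le_sum key).trans (le_of_eq ?_))
  simp; ring

theorem BddFun.abs_apply_le {L : ℕ} (f : BddFun L) (x : JointState L) : |f x| ≤ ‖f‖ :=
  lp.norm_apply_le_norm ENNReal.top_ne_zero f x

theorem memℓp_jointGenFun (w μ : ℝ) (L : ℕ) (f : BddFun L) :
    Memℓp (E := fun _ : JointState L => ℝ) (jointGenFun w μ L f) ∞ := by
  refine memℓp_infty ⟨(L * (2 * |μ| + 4 * |w|)) * ‖f‖, ?_⟩
  rintro _ ⟨x, rfl⟩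
  exact abs_jointGenFun_le w μ L f _ (BddFun.abs_apply_le f) x

/-- The generator of the joint process as a bounded operator on bounded functions. -/
def jointGen (w μ : ℝ) (L : ℕ) : BddFun L →L[ℝ] BddFun L :=
  LinearMap.mkContinuous
    { toFun := fun f => ⟨jointGenFun w μ L f, memℓp_jointGenFun w μ L f⟩
      map_add' := by
        intro f g
        ext x
        simp only [lp.coeFn_add, Pi.add_apply, jointGenFun]
        rw [← Finset.sum_add_distrib]
        exact Finset.sum_congr rfl fun k _ => by ring
      map_smul' := by
        intro c f
        ext x
        simp only [lp.coeFn_smul, Pi.smul_apply, jointGenFun, smul_eq_mul, RingHom.id_apply]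
        rw [Finset.mul_sum]
        exact Finset.sum_congr rfl fun k _ => by ring }
    (L * (2 * |μ| + 4 * |w|))
    (fun f => lp.norm_le_of_forall_le (by positivity)
      (fun x => abs_jointGenFun_le w μ L f _ (BddFun.abs_apply_le f) x))

/-- The Markov semigroup `exp (t 𝓗̃)` of the joint process. -/
def semigroup (w μ : ℝ) (L : ℕ) (t : ℝ) : BddFun L →L[ℝ] BddFun L :=
  NormedSpace.exp (t • jointGen w μ L)

/-- The indicator function of the event that the activity equals `a`. -/
def activityIndicator (L : ℕ) (a : ℕ) : BddFun L :=
  ⟨fun x => if x.2 = a then 1 else 0, memℓp_infty ⟨1, by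
    rintro _ ⟨x, rfl⟩
    dsimp only
    split <;> simp⟩⟩

/-- The probability that the activity at time `t` equals `a` for the process started from
configuration `η` with activity `0`. -/
def activityProb (w μ : ℝ) (L : ℕ) (η : Config L) (t : ℝ) (a : ℕ) : ℝ :=
  (semigroup w μ L t (activityIndicator L a) : JointState L → ℝ) (η, 0)

/-- The moment generating function `𝔼_{η,0}[exp (s A(t))]` of the activity. -/
def momentGen (w μ : ℝ) (L : ℕ) (η : Config L) (s t : ℝ) : ℝ :=
  ∑' a : ℕ, Real.exp (s * a) * activityProb w μ L η t a

/-- The scaled cumulant generating function at time `t`, `(L t)⁻¹ log 𝔼_{η,0}[exp (s A(t))]`. -/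
def scaledCGF (w μ : ℝ) (L : ℕ) (η : Config L) (s t : ℝ) : ℝ :=
  Real.log (momentGen w μ L η s t) / (L * t)

/-- The long-time limit of the scaled cumulant generating function in the even sector. -/
def limitCGF (w μ : ℝ) (L : ℕ) (s : ℝ) : ℝ :=
  limUnder atTop (fun t : ℝ => scaledCGF w μ L (emptyConfig L) s t)

/-- The critical point `s_c = log (1 - μ/w)`. -/
def criticalPoint (w μ : ℝ) : ℝ := Real.log (1 - μ / w)

/-- The `n`-th cumulant at the critical point for system size `L` in the even sector. -/
def criticalCumulant (w μ : ℝ) (n L : ℕ) : ℝ :=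
  iteratedDeriv n (limitCGF w μ L) (criticalPoint w μ)

/-- `α_m = (1 - 2^(1-2m)) ζ(2m-1) / π^(2m-1)`, used for `m ≥ 2` only. -/
def alpha (m : ℕ) : ℝ :=
  (1 - (2 : ℝ) ^ (1 - 2 * (m : ℤ))) / Real.pi ^ (2 * m - 1) * (riemannZeta (2 * m - 1)).re

/-- `β_{2m}(ν) = ν^(2m) binom(1/2, m) / (1 - ν²)^(m - 1/2)`. -/
def betaEven (ν : ℝ) (m : ℕ) : ℝ :=
  ν ^ (2 * m) * Ring.choose (1 / 2 : ℝ) m / (1 - ν ^ 2) ^ ((m : ℝ) - 1 / 2)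

/-- The rescaled cumulant `κ*_{2m} = (2m)! α_m β_{2m}(ν)` of even order `2m`. -/
def kappaStarEven (ν : ℝ) (m : ℕ) : ℝ :=
  (Nat.factorial (2 * m) : ℝ) * alpha m * betaEven ν m

end DLPAD

end

/-!
For functions of the configuration, fermionic creation and annihilation operators are built with a
Jordan–Wigner sign. On the even sector the tilted generator at fugacity `z = exp s` is quadratic in
them with antiperiodic boundary conditions, so that it is diagonalised by pairing the momenta `±q`.
The resulting pair state is an explicit eigenvector with eigenvalue
`-(μ + w) L + ∑ √(dispersion q)`, the sum running over the antiperiodic momenta. At `z = 1` the pair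
state is the constant `1`. A nonnegative eigenvector that vanishes anywhere on the even sector
vanishes identically there, so positivity persists along the connected interval `0 < z ≤ 1`.
Comparing the pair state with constants under the Markov semigroup then identifies the limiting
cumulant generating function with this eigenvalue divided by `L`.

At the critical point the dispersion of a mode is `σ²` times a positive number, `σ = sin (q / 2)`,
and deviations of `s` from `s_c` may be rescaled by `σ`. Hence the `n`-th derivative of the square
root is `σ^(1 - n)` times a coefficient which is smooth in `σ` up to `σ = 0`. This coefficient is
nonzero at `σ = 0` for even `n`, and has a simple zero there for odd `n ≥ 3`. Both cumulants of
orders `2k` and `2k + 1` are therefore of the order of the mean of `σ^(1 - 2k)`, which diverges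
with `L`. For `k ≥ 2` it is dominated by the momenta closest to zero, where `σ` is
proportional to an odd integer divided by `L`, and this produces the zeta value.
-/

noncomputable section

namespace DLPAD

section QuadPow

variable {R : Type*} [CommRing R] [BinomialRing R]

theorem choose_add_one_mul (r : R) (m : ℕ) :
    Ring.choose r (m + 1) * (m + 1) = Ring.choose r m * (r - m) := by
  simpa [mul_comm] using Ring.choose_smul_choose r m.le_succ

theorem ringChoose_ne_zero [IsDomain R] {r : R} (hr : ∀ i : ℕ, r ≠ i) (m : ℕ) :
    Ring.choose r m ≠ 0 := by
  induction m with
  | zero => simp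
  | succ m ih =>
    exact left_ne_zero_of_mul (choose_add_one_mul r m ▸ mul_ne_zero ih (sub_ne_zero.2 (hr m)))

/-- The formal power series `(1 + c X²) ^ r` with a binomial exponent `r`. -/
def quadPow (c r : R) : PowerSeries R :=
  PowerSeries.expand 2 two_ne_zero (PowerSeries.rescale c (PowerSeries.binomialSeries R r))

theorem coeff_quadPow_even (c r : R) (m : ℕ) :
    (quadPow c r).coeff (2 * m) = Ring.choose r m * c ^ m := by
  rw [quadPow, PowerSeries.coeff_expand_mul, PowerSeries.coeff_rescale,
    PowerSeries.binomialSeries_coeff, smul_eq_mul, mul_one, mul_comm]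

theorem coeff_quadPow_odd (c r : R) (m : ℕ) : (quadPow c r).coeff (2 * m + 1) = 0 :=
  PowerSeries.coeff_expand_of_not_dvd _ _ _ (by omega)

theorem constantCoeff_quadPow (c r : R) : (quadPow c r).constantCoeff = 1 := by
  simpa using coeff_quadPow_even c r 0

theorem quadPow_add (c r s : R) : quadPow c (r + s) = quadPow c r * quadPow c s := by
  simp only [quadPow, PowerSeries.binomialSeries_add, map_mul]

theorem quadPow_zero (c : R) : quadPow c 0 = 1 := by
  simp [quadPow, PowerSeries.binomialSeries_zero]

theorem quadPow_one (c : R) : quadPow c 1 = 1 + PowerSeries.C c * PowerSeries.X ^ 2 := by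
  have h := PowerSeries.binomialSeries_nat (R := R) (A := R) 1
  rw [Nat.cast_one, pow_one] at h
  simp only [quadPow, h, map_add, map_one, PowerSeries.rescale_X, map_mul, PowerSeries.expand_C,
    PowerSeries.expand_X]

end QuadPow

section SqrtSeries

/-- The coefficients of `sqrtSeries`. -/
def sqrtCoeff (A : PowerSeries ℝ) : ℕ → ℝ
  | 0 => √(A.coeff 0)
  | n + 1 => (A.coeff (n + 1) - ∑ i : Fin n, sqrtCoeff A (i + 1) * sqrtCoeff A (n - i))
      / (2 * √(A.coeff 0))

/-- The formal square root of a power series with positive constant coefficient, normalized to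
have a positive constant coefficient itself. It is junk if `A.coeff 0 ≤ 0`. -/
def sqrtSeries (A : PowerSeries ℝ) : PowerSeries ℝ := PowerSeries.mk (sqrtCoeff A)

theorem coeff_zero_sqrtSeries (A : PowerSeries ℝ) : (sqrtSeries A).coeff 0 = √(A.coeff 0) := by
  rw [sqrtSeries, PowerSeries.coeff_mk, sqrtCoeff]

theorem coeff_succ_sqrtSeries (A : PowerSeries ℝ) (n : ℕ) :
    (sqrtSeries A).coeff (n + 1) = (A.coeff (n + 1) - ∑ i ∈ Finset.range n,
      (sqrtSeries A).coeff (i + 1) * (sqrtSeries A).coeff (n - i)) / (2 * √(A.coeff 0)) := by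
  simp only [sqrtSeries, PowerSeries.coeff_mk]
  rw [sqrtCoeff, ← Fin.sum_univ_eq_sum_range fun i => sqrtCoeff A (i + 1) * sqrtCoeff A (n - i)]

theorem sqrtSeries_mul_self {A : PowerSeries ℝ} (hA : 0 < A.coeff 0) :
    sqrtSeries A * sqrtSeries A = A := by
  ext n
  rw [PowerSeries.coeff_mul, Finset.Nat.sum_antidiagonal_eq_sum_range_succ
    (fun i j => (sqrtSeries A).coeff i * (sqrtSeries A).coeff j)]
  cases n with
  | zero => simpa [coeff_zero_sqrtSeries] using Real.mul_self_sqrt hA.le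
  | succ n =>
    have hs : √(A.coeff 0) ≠ 0 := (Real.sqrt_pos.2 hA).ne'
    rw [Finset.sum_range_succ', Finset.sum_range_succ]
    simp only [Nat.add_sub_add_right, Nat.sub_self, Nat.sub_zero, coeff_zero_sqrtSeries]
    rw [coeff_succ_sqrtSeries A n]
    field_simp
    ring

theorem eq_sqrtSeries {A B : PowerSeries ℝ} (hB : 0 < B.coeff 0) (h : B * B = A) :
    B = sqrtSeries A := by
  have hA : 0 < A.coeff 0 := by simpa [← h, PowerSeries.coeff_mul] using hB.ne'
  refine (mul_self_eq_mul_self_iff.1 (h.trans (sqrtSeries_mul_self hA).symm)).resolve_right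
    fun hneg => hB.not_ge ?_
  rw [hneg, map_neg, coeff_zero_sqrtSeries]
  exact neg_nonpos.2 (Real.sqrt_nonneg _)

theorem rescale_sqrtSeries {A : PowerSeries ℝ} (hA : 0 < A.coeff 0) (r : ℝ) :
    PowerSeries.rescale r (sqrtSeries A) = sqrtSeries (PowerSeries.rescale r A) := by
  refine eq_sqrtSeries ?_ (by rw [← map_mul, sqrtSeries_mul_self hA])
  rw [PowerSeries.coeff_rescale, coeff_zero_sqrtSeries, pow_zero, one_mul]
  exact Real.sqrt_pos.2 hA

theorem C_mul_sqrtSeries {A : PowerSeries ℝ} (hA : 0 < A.coeff 0) {c : ℝ} (hc : 0 < c) :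
    PowerSeries.C c * sqrtSeries A = sqrtSeries (PowerSeries.C (c ^ 2) * A) := by
  refine eq_sqrtSeries ?_ ?_
  · rw [PowerSeries.coeff_C_mul, coeff_zero_sqrtSeries]
    exact mul_pos hc (Real.sqrt_pos.2 hA)
  · rw [mul_mul_mul_comm, sqrtSeries_mul_self hA, ← map_mul, sq]

theorem sqrtSeries_quadPow (c : ℝ) : sqrtSeries (quadPow c 1) = quadPow c (1 / 2) := by
  refine (eq_sqrtSeries ?_ ?_).symm
  · rw [PowerSeries.coeff_zero_eq_constantCoeff_apply, constantCoeff_quadPow]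
    exact one_pos
  · rw [← quadPow_add, add_halves]

end SqrtSeries

section TaylorSeries

variable {𝕜 : Type*} [NontriviallyNormedField 𝕜] {f g : 𝕜 → 𝕜} {x : 𝕜}

/-- The formal Taylor series of `f` at `x`. -/
def taylorSeries (f : 𝕜 → 𝕜) (x : 𝕜) : PowerSeries 𝕜 :=
  PowerSeries.mk fun n => iteratedDeriv n f x / n.factorial

theorem coeff_taylorSeries (f : 𝕜 → 𝕜) (x : 𝕜) (n : ℕ) :
    (taylorSeries f x).coeff n = iteratedDeriv n f x / n.factorial :=
  PowerSeries.coeff_mk _ _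

theorem taylorSeries_const (c x : 𝕜) : taylorSeries (fun _ => c) x = PowerSeries.C c := by
  ext n
  rw [coeff_taylorSeries, iteratedDeriv_const, PowerSeries.coeff_C]
  split_ifs with h <;> simp [h]

theorem taylorSeries_add (hf : ContDiffAt 𝕜 ⊤ f x) (hg : ContDiffAt 𝕜 ⊤ g x) :
    taylorSeries (fun y => f y + g y) x = taylorSeries f x + taylorSeries g x := by
  ext n
  rw [map_add, coeff_taylorSeries, coeff_taylorSeries, coeff_taylorSeries,
    iteratedDeriv_fun_add (hf.of_le le_top) (hg.of_le le_top), add_div]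

theorem taylorSeries_mul [CharZero 𝕜] (hf : ContDiffAt 𝕜 ⊤ f x) (hg : ContDiffAt 𝕜 ⊤ g x) :
    taylorSeries (fun y => f y * g y) x = taylorSeries f x * taylorSeries g x := by
  ext n
  rw [PowerSeries.coeff_mul, Finset.Nat.sum_antidiagonal_eq_sum_range_succ
    (fun i j => (taylorSeries f x).coeff i * (taylorSeries g x).coeff j), coeff_taylorSeries,
    iteratedDeriv_fun_mul (hf.of_le le_top) (hg.of_le le_top), Finset.sum_div]
  refine Finset.sum_congr rfl fun i hi => ?_
  have hn : (n.factorial : 𝕜) ≠ 0 := Nat.cast_ne_zero.2 n.factorial_ne_zero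
  rw [coeff_taylorSeries, coeff_taylorSeries,
    Nat.cast_choose 𝕜 (Nat.lt_succ_iff.1 (Finset.mem_range.1 hi))]
  field_simp

theorem taylorSeries_sqrt {f : ℝ → ℝ} {x : ℝ} (hf : ContDiffAt ℝ ⊤ f x) (hx : 0 < f x) :
    taylorSeries (fun y => √(f y)) x = sqrtSeries (taylorSeries f x) := by
  have hs : ContDiffAt ℝ ⊤ (fun y => √(f y)) x := hf.sqrt hx.ne'
  refine eq_sqrtSeries ?_ ?_
  · simpa [coeff_taylorSeries] using hx
  · have h : (fun y => √(f y) * √(f y)) =ᶠ[𝓝 x] f :=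
      (hf.continuousAt.eventually (lt_mem_nhds hx)).mono fun y hy => Real.mul_self_sqrt hy.le
    rw [← taylorSeries_mul hs hs]
    ext n
    rw [coeff_taylorSeries, coeff_taylorSeries, h.iteratedDeriv_eq]

end TaylorSeries

section CoeffDeriv

/-- Coefficientwise differentiability at `x` of a one-parameter family of power series. -/
def HasCoeffDerivAt (A : ℝ → PowerSeries ℝ) (A' : PowerSeries ℝ) (x : ℝ) : Prop :=
  ∀ n, HasDerivAt (fun y => (A y).coeff n) (A'.coeff n) x

variable {A B : ℝ → PowerSeries ℝ} {A' B' : PowerSeries ℝ} {x : ℝ}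

theorem hasCoeffDerivAt_C {f : ℝ → ℝ} {f' : ℝ} (hf : HasDerivAt f f' x) :
    HasCoeffDerivAt (fun y => PowerSeries.C (f y)) (PowerSeries.C f') x := by
  intro n
  simp only [PowerSeries.coeff_C]
  split_ifs
  · exact hf
  · exact hasDerivAt_const x 0

theorem HasCoeffDerivAt.add (hA : HasCoeffDerivAt A A' x) (hB : HasCoeffDerivAt B B' x) :
    HasCoeffDerivAt (fun y => A y + B y) (A' + B') x := by
  intro n
  simpa only [map_add] using (hA n).fun_add (hB n)

theorem HasCoeffDerivAt.mul (hA : HasCoeffDerivAt A A' x) (hB : HasCoeffDerivAt B B' x) :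
    HasCoeffDerivAt (fun y => A y * B y) (A' * B x + A x * B') x := by
  intro n
  simp only [map_add, PowerSeries.coeff_mul, ← Finset.sum_add_distrib]
  exact HasDerivAt.fun_sum fun p _ => (hA p.1).mul (hB p.2)

theorem HasCoeffDerivAt.differentiableAt_sqrtSeries (hA : HasCoeffDerivAt A A' x)
    (hx : 0 < (A x).coeff 0) (n : ℕ) :
    DifferentiableAt ℝ (fun y => (sqrtSeries (A y)).coeff n) x := by
  have hs : DifferentiableAt ℝ (fun y => √((A y).coeff 0)) x :=
    (hA 0).differentiableAt.sqrt hx.ne'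
  induction n using Nat.strong_induction_on with
  | _ n ih =>
    cases n with
    | zero => simpa only [coeff_zero_sqrtSeries] using hs
    | succ n =>
      rw [funext fun y => coeff_succ_sqrtSeries (A y) n]
      refine ((hA (n + 1)).differentiableAt.sub (DifferentiableAt.fun_sum fun i hi => ?_)).div
        (hs.const_mul 2) (mul_ne_zero two_ne_zero (Real.sqrt_pos.2 hx).ne')
      have hi := Finset.mem_range.1 hi
      exact (ih (i + 1) (by omega)).mul (ih (n - i) (by omega))

theorem HasCoeffDerivAt.sqrt (hA : HasCoeffDerivAt A A' x) (hx : 0 < (A x).coeff 0) :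
    HasCoeffDerivAt (fun y => sqrtSeries (A y)) (A' * (2 * sqrtSeries (A x))⁻¹) x := by
  set S := fun y => sqrtSeries (A y)
  set S' : PowerSeries ℝ := PowerSeries.mk fun n => deriv (fun y => (S y).coeff n) x
  have hS : HasCoeffDerivAt S S' x := fun n => by
    simpa only [S', PowerSeries.coeff_mk] using
      (hA.differentiableAt_sqrtSeries hx n).hasDerivAt
  have hsq : S' * S x + S x * S' = A' := by
    ext n
    refine ((hS.mul hS) n).unique ((hA n).congr_of_eventuallyEq ?_)
    filter_upwards [(hA 0).continuousAt.eventually (lt_mem_nhds hx)] with y hy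
    rw [sqrtSeries_mul_self hy]
  have hS0 : (2 * S x).constantCoeff ≠ 0 := by
    rw [map_mul, map_ofNat, ← PowerSeries.coeff_zero_eq_constantCoeff_apply,
      coeff_zero_sqrtSeries]
    exact mul_ne_zero two_ne_zero (Real.sqrt_pos.2 hx).ne'
  have hS' : S' = A' * (2 * S x)⁻¹ :=
    (PowerSeries.eq_mul_inv_iff_mul_eq hS0).2 (by linear_combination hsq)
  exact hS' ▸ hS

end CoeffDeriv

section Dispersion

/-- The antiperiodic momenta `(2 j + 1) π / L` of the even sector. -/
def momentum (L j : ℕ) : ℝ := (2 * j + 1) * Real.pi / L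

/-- The squared single-particle energy at momentum `q` and fugacity `z = exp s`. -/
def dispersion (w μ z q : ℝ) : ℝ :=
  ((μ + w * z) * Real.cos q - w) ^ 2 + μ * (μ + 2 * w * z) * Real.sin q ^ 2

/-- The largest eigenvalue of the tilted generator in the even sector, at fugacity `z`. -/
def topEigenvalue (w μ : ℝ) (L : ℕ) (z : ℝ) : ℝ :=
  -(μ + w) * L + ∑ j ∈ Finset.range L, √(dispersion w μ z (momentum L j))

/-- The value `sin (q / 2)` at the antiperiodic momentum `q = momentum L j`. -/
def sinHalf (L j : ℕ) : ℝ := Real.sin ((2 * j + 1) * Real.pi / (2 * L))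

theorem sinHalf_eq (L j : ℕ) : sinHalf L j = Real.sin (momentum L j / 2) := by
  rw [sinHalf, momentum, div_div, mul_comm (L : ℝ)]

/-- The squared energy divided by `w ^ 2`, in terms of `σ = sin (q / 2)`, expanded in powers of the
distance of the fugacity `z` from its critical value `ν`. -/
def reducedDispersion (ν σ z : ℝ) : ℝ :=
  4 * σ ^ 2 * (1 - ν ^ 2 + ν ^ 2 * σ ^ 2) + 4 * σ ^ 2 * (1 - 2 * ν * (1 - σ ^ 2)) * (z - ν)
    + (1 - 2 * σ ^ 2) ^ 2 * (z - ν) ^ 2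

theorem dispersion_eq {w : ℝ} (hw : w ≠ 0) (μ z q : ℝ) :
    dispersion w μ z q = w ^ 2 * reducedDispersion (1 - μ / w) (Real.sin (q / 2)) z := by
  have hq : Real.cos q = 1 - 2 * Real.sin (q / 2) ^ 2 := by
    rw [← mul_div_cancel₀ q two_ne_zero, Real.cos_two_mul, Real.cos_sq',
      mul_div_cancel_left₀ _ two_ne_zero]
    ring
  rw [dispersion, Real.sin_sq, hq, reducedDispersion]
  field_simp
  ring

/-- The single-particle energy divided by `w`, as a function of `s`, in terms of
`σ = sin (q / 2)`. -/
def energy (ν σ s : ℝ) : ℝ := √(reducedDispersion ν σ (Real.exp s))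

theorem criticalGap_pos {ν : ℝ} (h0 : 0 < ν) (h1 : ν < 1) (σ : ℝ) :
    0 < 1 - ν ^ 2 + ν ^ 2 * σ ^ 2 :=
  add_pos_of_pos_of_nonneg (sub_pos.2 (pow_lt_one₀ h0.le h1 two_ne_zero))
    (mul_nonneg (sq_nonneg ν) (sq_nonneg σ))

theorem reducedDispersion_critical_pos {ν σ : ℝ} (h0 : 0 < ν) (h1 : ν < 1) (hσ : 0 < σ) :
    0 < reducedDispersion ν σ (Real.exp (Real.log ν)) := by
  have hgap := criticalGap_pos h0 h1 σ
  rw [Real.exp_log h0, reducedDispersion, sub_self, mul_zero, add_zero, zero_pow two_ne_zero,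
    mul_zero, add_zero]
  positivity

theorem contDiff_reducedDispersion_exp (ν σ : ℝ) (n : WithTop ℕ∞) :
    ContDiff ℝ n fun s => reducedDispersion ν σ (Real.exp s) := by
  unfold reducedDispersion
  fun_prop

theorem contDiffAt_energy {ν σ : ℝ} (h0 : 0 < ν) (h1 : ν < 1) (hσ : 0 < σ)
    (n : WithTop ℕ∞) : ContDiffAt ℝ n (energy ν σ) (Real.log ν) :=
  (contDiff_reducedDispersion_exp ν σ n).contDiffAt.sqrt
    (reducedDispersion_critical_pos h0 h1 hσ).ne'

end Dispersion

section GapSeries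

open PowerSeries

theorem rescale_C {R : Type*} [CommSemiring R] (r c : R) : rescale r (C c) = C c := by
  ext n
  cases n <;> simp [coeff_C]

/-- The power series `(exp (σ X) - 1) / σ`, continued to `X` at `σ = 0`. -/
def expSlope (σ : ℝ) : PowerSeries ℝ :=
  X * PowerSeries.mk fun n => σ ^ n / (n + 1).factorial

/-- The coefficientwise derivative of `expSlope` in `σ`. -/
def expSlopeDeriv (σ : ℝ) : PowerSeries ℝ :=
  X * PowerSeries.mk fun n => n * σ ^ (n - 1) / (n + 1).factorial

theorem C_mul_expSlope (σ : ℝ) : C σ * expSlope σ = rescale σ (exp ℝ) - 1 := by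
  ext n
  cases n with
  | zero =>
    rw [map_sub, coeff_rescale]
    simp [expSlope]
  | succ n =>
    simp only [expSlope, coeff_C_mul, coeff_succ_X_mul, coeff_mk, map_sub, coeff_rescale, coeff_exp,
      coeff_one, Nat.add_one_ne_zero, if_false, sub_zero, map_div₀, map_one, map_natCast]
    ring

theorem expSlope_zero : expSlope 0 = X := by
  ext n
  rcases n with _ | _ | n <;> simp [expSlope, coeff_X]

theorem expSlopeDeriv_zero : expSlopeDeriv 0 = C (1 / 2) * X ^ 2 := by
  ext n
  rcases n with _ | _ | _ | n <;> simp [expSlopeDeriv, coeff_X_pow]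

theorem hasCoeffDerivAt_expSlope (σ : ℝ) : HasCoeffDerivAt expSlope (expSlopeDeriv σ) σ := by
  intro n
  cases n with
  | zero => simpa [expSlope, expSlopeDeriv] using hasDerivAt_const σ (0 : ℝ)
  | succ n =>
    simpa only [expSlope, expSlopeDeriv, coeff_succ_X_mul, coeff_mk] using
      (hasDerivAt_pow n σ).div_const _

/-- The Taylor series of `energy ν σ ^ 2` at the critical point in the variable `(s - s_c) / σ`,
divided by `σ ^ 2`. Unlike the Taylor series itself it is nondegenerate at `σ = 0`. -/
def dispersionSeries (ν σ : ℝ) : PowerSeries ℝ :=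
  C (4 * (1 - ν ^ 2 + ν ^ 2 * σ ^ 2)) + C (4 * ν * σ * (1 - 2 * ν * (1 - σ ^ 2))) * expSlope σ
    + C (ν ^ 2 * (1 - 2 * σ ^ 2) ^ 2) * (expSlope σ * expSlope σ)

theorem coeff_zero_dispersionSeries (ν σ : ℝ) :
    (dispersionSeries ν σ).coeff 0 = 4 * (1 - ν ^ 2 + ν ^ 2 * σ ^ 2) := by
  simp [dispersionSeries, expSlope]

theorem coeff_zero_dispersionSeries_pos {ν : ℝ} (h0 : 0 < ν) (h1 : ν < 1) (σ : ℝ) :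
    0 < (dispersionSeries ν σ).coeff 0 := by
  rw [coeff_zero_dispersionSeries]
  exact mul_pos four_pos (criticalGap_pos h0 h1 σ)

theorem hasCoeffDerivAt_dispersionSeries (ν σ : ℝ) :
    HasCoeffDerivAt (dispersionSeries ν)
      (C (8 * ν ^ 2 * σ)
        + (C (4 * ν * (1 - 2 * ν * (1 - 3 * σ ^ 2))) * expSlope σ
          + C (4 * ν * σ * (1 - 2 * ν * (1 - σ ^ 2))) * expSlopeDeriv σ)
        + (C (-(8 * ν ^ 2 * σ * (1 - 2 * σ ^ 2))) * (expSlope σ * expSlope σ)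
          + C (ν ^ 2 * (1 - 2 * σ ^ 2) ^ 2)
            * (expSlopeDeriv σ * expSlope σ + expSlope σ * expSlopeDeriv σ))) σ := by
  have hsq : HasDerivAt (fun σ : ℝ => σ ^ 2) (2 * σ) σ := by simpa using hasDerivAt_pow 2 σ
  have hE := hasCoeffDerivAt_expSlope σ
  refine ((hasCoeffDerivAt_C ?_).add ((hasCoeffDerivAt_C ?_).mul hE)).add
    ((hasCoeffDerivAt_C ?_).mul (hE.mul hE))
  · exact (((hsq.const_mul (ν ^ 2)).const_add (1 - ν ^ 2)).const_mul 4).congr_deriv (by ring)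
  · exact (((hasDerivAt_id' σ).const_mul (4 * ν)).mul
      (((hsq.const_sub 1).const_mul (2 * ν)).const_sub 1)).congr_deriv (by ring)
  · exact ((((hsq.const_mul 2).const_sub 1).fun_pow 2).const_mul (ν ^ 2)).congr_deriv
      (by push_cast; ring)

theorem dispersionSeries_zero {ν : ℝ} (h0 : 0 < ν) (h1 : ν < 1) :
    dispersionSeries ν 0 =
      C (√(4 * (1 - ν ^ 2)) ^ 2) * quadPow (ν ^ 2 / (4 * (1 - ν ^ 2))) 1 := by
  have hc : 0 < 4 * (1 - ν ^ 2) := by simpa using criticalGap_pos h0 h1 0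
  rw [Real.sq_sqrt hc.le, quadPow_one, mul_add, mul_one, ← mul_assoc, ← map_mul,
    mul_div_cancel₀ _ hc.ne', dispersionSeries, expSlope_zero]
  simp [sq]

theorem C_sq_mul_dispersionSeries {ν : ℝ} (h0 : 0 < ν) (σ : ℝ) :
    C (σ ^ 2) * dispersionSeries ν σ =
      rescale σ (taylorSeries (fun s => reducedDispersion ν σ (Real.exp s)) (Real.log ν)) := by
  have hz : ContDiffAt ℝ ⊤ (fun s => Real.exp s + -ν) (Real.log ν) :=
    (Real.contDiff_exp.add contDiff_const).contDiffAt
  have hcd (c : ℝ) : ContDiffAt ℝ ⊤ (fun _ : ℝ => c) (Real.log ν) := contDiffAt_const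
  have hexp : taylorSeries Real.exp (Real.log ν) = C ν * exp ℝ := by
    ext n
    rw [coeff_taylorSeries, iteratedDeriv_eq_iterate, Real.iter_deriv_exp, Real.exp_log h0,
      coeff_C_mul, coeff_exp]
    simp [div_eq_mul_inv]
  have hslope : rescale σ (taylorSeries (fun s => Real.exp s + -ν) (Real.log ν)) =
      C (ν * σ) * expSlope σ := by
    rw [taylorSeries_add Real.contDiff_exp.contDiffAt (hcd _), taylorSeries_const, hexp, map_add,
      map_mul, rescale_C, rescale_C, map_mul, mul_assoc, C_mul_expSlope, map_neg]
    ring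
  simp only [reducedDispersion, sub_eq_add_neg _ ν, sq (_ + -ν)]
  rw [taylorSeries_add ((hcd _).add ((hcd _).mul hz)) ((hcd _).mul (hz.mul hz)),
    taylorSeries_add (hcd _) ((hcd _).mul hz), taylorSeries_mul (hcd _) hz,
    taylorSeries_mul (hcd _) (hz.mul hz), taylorSeries_mul hz hz]
  simp only [taylorSeries_const, map_add, map_mul, map_sub, map_pow, map_one, map_ofNat, rescale_C,
    hslope, dispersionSeries]
  ring

/-- The Taylor series of `energy ν σ` at the critical point in the variable `(s - s_c) / σ`,
divided by `σ`. -/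
def gapSeries (ν σ : ℝ) : PowerSeries ℝ := sqrtSeries (dispersionSeries ν σ)

theorem rescale_taylorSeries_energy {ν σ : ℝ} (h0 : 0 < ν) (h1 : ν < 1) (hσ : 0 < σ) :
    rescale σ (taylorSeries (energy ν σ) (Real.log ν)) = C σ * gapSeries ν σ := by
  have hpos := reducedDispersion_critical_pos h0 h1 hσ
  have hcoeff : 0 < (taylorSeries (fun s => reducedDispersion ν σ (Real.exp s))
      (Real.log ν)).coeff 0 := by
    simpa [coeff_taylorSeries] using hpos
  rw [gapSeries, C_mul_sqrtSeries (coeff_zero_dispersionSeries_pos h0 h1 σ) hσ,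
    C_sq_mul_dispersionSeries h0, ← rescale_sqrtSeries hcoeff,
    ← taylorSeries_sqrt (contDiff_reducedDispersion_exp ν σ ⊤).contDiffAt hpos]
  rfl

theorem differentiable_coeff_gapSeries {ν : ℝ} (h0 : 0 < ν) (h1 : ν < 1) (n : ℕ) :
    Differentiable ℝ fun σ => (gapSeries ν σ).coeff n := fun σ =>
  (hasCoeffDerivAt_dispersionSeries ν σ).differentiableAt_sqrtSeries
    (coeff_zero_dispersionSeries_pos h0 h1 σ) n

theorem gapSeries_zero {ν : ℝ} (h0 : 0 < ν) (h1 : ν < 1) :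
    gapSeries ν 0 = C √(4 * (1 - ν ^ 2)) * quadPow (ν ^ 2 / (4 * (1 - ν ^ 2))) (1 / 2) := by
  have hc : 0 < 4 * (1 - ν ^ 2) := by simpa using criticalGap_pos h0 h1 0
  rw [gapSeries, dispersionSeries_zero h0 h1, ← C_mul_sqrtSeries _ (Real.sqrt_pos.2 hc),
    sqrtSeries_quadPow]
  rw [coeff_zero_eq_constantCoeff_apply, constantCoeff_quadPow]
  exact one_pos

theorem coeff_even_gapSeries_zero {ν : ℝ} (h0 : 0 < ν) (h1 : ν < 1) (m : ℕ) :
    (gapSeries ν 0).coeff (2 * m) = √(4 * (1 - ν ^ 2))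
      * (Ring.choose (1 / 2 : ℝ) m * (ν ^ 2 / (4 * (1 - ν ^ 2))) ^ m) := by
  rw [gapSeries_zero h0 h1, coeff_C_mul, coeff_quadPow_even]

theorem coeff_odd_gapSeries_zero {ν : ℝ} (h0 : 0 < ν) (h1 : ν < 1) (m : ℕ) :
    (gapSeries ν 0).coeff (2 * m + 1) = 0 := by
  rw [gapSeries_zero h0 h1, coeff_C_mul, coeff_quadPow_odd, mul_zero]

theorem coeff_even_gapSeries_zero_ne_zero {ν : ℝ} (h0 : 0 < ν) (h1 : ν < 1) (m : ℕ) :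
    (gapSeries ν 0).coeff (2 * m) ≠ 0 := by
  have hc : 0 < 4 * (1 - ν ^ 2) := by simpa using criticalGap_pos h0 h1 0
  have hchoose : Ring.choose (1 / 2 : ℝ) m ≠ 0 := ringChoose_ne_zero (fun i hi => by
    have : 1 = 2 * i := by exact_mod_cast (by linarith : (1 : ℝ) = 2 * i)
    omega) m
  rw [coeff_even_gapSeries_zero h0 h1]
  exact mul_ne_zero (Real.sqrt_pos.2 hc).ne' (mul_ne_zero hchoose (by positivity))

theorem hasCoeffDerivAt_dispersionSeries_zero (ν : ℝ) :
    HasCoeffDerivAt (dispersionSeries ν) (C (4 * ν * (1 - 2 * ν)) * X + C (ν ^ 2) * X ^ 3) 0 := by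
  convert hasCoeffDerivAt_dispersionSeries ν 0 using 1
  have htwo : C (1 / 2 : ℝ) * 2 = 1 := by
    rw [← map_ofNat C, ← map_mul, div_mul_cancel₀ _ two_ne_zero, map_one]
  rw [expSlope_zero, expSlopeDeriv_zero]
  simp only [map_mul, map_sub, map_neg, map_pow, map_zero, map_one, map_ofNat]
  linear_combination -(C ν ^ 2 * X ^ 3) * htwo

theorem inv_two_mul_gapSeries_zero {ν : ℝ} (h0 : 0 < ν) (h1 : ν < 1) :
    (2 * gapSeries ν 0)⁻¹ =
      C (2 * √(4 * (1 - ν ^ 2)))⁻¹ * quadPow (ν ^ 2 / (4 * (1 - ν ^ 2))) (-1 / 2) := by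
  have hc : 0 < √(4 * (1 - ν ^ 2)) := Real.sqrt_pos.2 (by simpa using criticalGap_pos h0 h1 0)
  have hQ : quadPow (ν ^ 2 / (4 * (1 - ν ^ 2))) (-1 / 2)
      * quadPow (ν ^ 2 / (4 * (1 - ν ^ 2))) (1 / 2) = 1 := by
    rw [← quadPow_add, neg_div, neg_add_cancel, quadPow_zero]
  have hC : C (2 * √(4 * (1 - ν ^ 2)))⁻¹ * (2 * C √(4 * (1 - ν ^ 2))) = 1 := by
    rw [← map_ofNat C, ← map_mul, ← map_mul, inv_mul_cancel₀ (by positivity), map_one]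
  refine ((eq_inv_iff_mul_eq_one ?_).2 ?_).symm
  · rw [gapSeries_zero h0 h1, map_mul, map_mul, constantCoeff_quadPow, constantCoeff_C, map_ofNat]
    positivity
  · rw [gapSeries_zero h0 h1]
    linear_combination hC + C (2 * √(4 * (1 - ν ^ 2)))⁻¹ * (2 * C √(4 * (1 - ν ^ 2))) * hQ

theorem deriv_coeff_odd_gapSeries_zero {ν : ℝ} (h0 : 0 < ν) (h1 : ν < 1) (k : ℕ) :
    deriv (fun σ => (gapSeries ν σ).coeff (2 * k + 3)) 0 = (2 * √(4 * (1 - ν ^ 2)))⁻¹ *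
      (4 * ν * (1 - 2 * ν)
          * (Ring.choose (-1 / 2 : ℝ) (k + 1) * (ν ^ 2 / (4 * (1 - ν ^ 2))) ^ (k + 1))
        + ν ^ 2 * (Ring.choose (-1 / 2 : ℝ) k * (ν ^ 2 / (4 * (1 - ν ^ 2))) ^ k)) := by
  have h := (hasCoeffDerivAt_dispersionSeries_zero ν).sqrt (coeff_zero_dispersionSeries_pos h0 h1 0)
  rw [← gapSeries, inv_two_mul_gapSeries_zero h0 h1] at h
  refine (h (2 * k + 3)).deriv.trans ?_
  rw [mul_left_comm, coeff_C_mul, add_mul, mul_assoc (C _), mul_assoc (C _), map_add,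
    coeff_C_mul, coeff_C_mul, coeff_X_pow_mul, coeff_quadPow_even,
    show 2 * k + 3 = 2 * (k + 1) + 1 by ring, coeff_succ_X_mul, coeff_quadPow_even]

theorem derivCoeff_pos {ν : ℝ} (h0 : 0 < ν) (h1 : ν < 1) {x : ℝ} (hx : 1 ≤ x) :
    0 < (1 - ν ^ 2) * x + ν * (1 - 2 * ν) * (1 / 2 - x) := by
  nlinarith [mul_pos h0 (sub_pos.2 h1), mul_nonneg (sub_nonneg.2 hx) (sub_nonneg.2 h1.le),
    mul_nonneg (sub_nonneg.2 hx) h0.le,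
    mul_nonneg (mul_nonneg (sub_nonneg.2 hx) h0.le) (sub_nonneg.2 h1.le)]

theorem deriv_coeff_odd_gapSeries_zero_ne_zero {ν : ℝ} (h0 : 0 < ν) (h1 : ν < 1) (k : ℕ) :
    deriv (fun σ => (gapSeries ν σ).coeff (2 * k + 3)) 0 ≠ 0 := by
  have hgap : 0 < 1 - ν ^ 2 := by simpa using criticalGap_pos h0 h1 0
  have hchoose : Ring.choose (-1 / 2 : ℝ) k ≠ 0 := ringChoose_ne_zero
    (fun i => (lt_of_lt_of_le (by norm_num) i.cast_nonneg).ne) k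
  have hpos := derivCoeff_pos h0 h1 (le_add_of_nonneg_left k.cast_nonneg : (1 : ℝ) ≤ k + 1)
  have hrec := choose_add_one_mul (-1 / 2 : ℝ) k
  rw [deriv_coeff_odd_gapSeries_zero h0 h1]
  refine mul_ne_zero (by positivity) fun hzero => ?_
  have hprod : Ring.choose (-1 / 2 : ℝ) k * ((ν ^ 2 / (4 * (1 - ν ^ 2))) ^ k * ν ^ 2
      * ((1 - ν ^ 2) * (k + 1) + ν * (1 - 2 * ν) * (1 / 2 - (k + 1)))) = 0 := by
    have hr : ν ^ 2 / (4 * (1 - ν ^ 2)) * (4 * (1 - ν ^ 2)) = ν ^ 2 :=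
      div_mul_cancel₀ _ (by positivity)
    rw [pow_succ] at hzero
    generalize ν ^ 2 / (4 * (1 - ν ^ 2)) = r at hzero hr ⊢
    linear_combination (k + 1) * (1 - ν ^ 2) * hzero
      - ν * (1 - 2 * ν) * r ^ k * (Ring.choose (-1 / 2 : ℝ) (k + 1) * (k + 1)) * hr
      - ν * (1 - 2 * ν) * ν ^ 2 * r ^ k * hrec
  exact mul_ne_zero hchoose (by positivity) hprod

end GapSeries

section SinHalf

theorem sinHalf_pos {L j : ℕ} (h : j < L) : 0 < sinHalf L j := by
  have hL : (0 : ℝ) < L := by exact_mod_cast (by omega : 0 < L)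
  have hj : (j : ℝ) + 1 ≤ L := by exact_mod_cast h
  refine Real.sin_pos_of_pos_of_lt_pi (by positivity) ?_
  rw [div_lt_iff₀ (by positivity)]
  nlinarith [Real.pi_pos]

theorem sinHalf_mem_Ioc {L j : ℕ} (h : j < L) : sinHalf L j ∈ Set.Ioc 0 1 :=
  ⟨sinHalf_pos h, Real.sin_le_one _⟩

theorem sinHalf_reflect {L j : ℕ} (h : j < L) : sinHalf L (L - 1 - j) = sinHalf L j := by
  have hL : (0 : ℝ) < L := by exact_mod_cast (by omega : 0 < L)
  unfold sinHalf
  rw [← Real.sin_pi_sub]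
  congr 1
  rw [Nat.cast_sub (by omega), Nat.cast_sub (by omega)]
  field_simp
  push_cast
  ring

theorem sum_sinHalf_fold (f : ℝ → ℝ) (L : ℕ) : ∑ j ∈ Finset.range L, f (sinHalf L j) =
    ∑ j ∈ Finset.range ((L + 1) / 2), f (sinHalf L j)
      + ∑ j ∈ Finset.range (L / 2), f (sinHalf L j) := by
  have h : L = (L + 1) / 2 + L / 2 := by omega
  conv_lhs => rw [h, Finset.sum_range_add, ← h]
  congr 1
  rw [← Finset.sum_range_reflect]
  refine Finset.sum_congr rfl fun j hj => ?_
  have hj := Finset.mem_range.1 hj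
  rw [← sinHalf_reflect (by omega : j < L)]
  congr 2
  omega

theorem tendsto_mul_sinHalf (j : ℕ) :
    Tendsto (fun L : ℕ => L * sinHalf L j) atTop (𝓝 ((2 * j + 1) * Real.pi / 2)) := by
  have hangle := tendsto_const_div_atTop_nhds_zero_nat ((2 * j + 1) * Real.pi / 2)
  have h := ((Real.continuous_sinc.tendsto 0).comp hangle).const_mul ((2 * j + 1) * Real.pi / 2)
  rw [Real.sinc_zero, mul_one] at h
  refine h.congr' ?_
  filter_upwards [eventually_gt_atTop 0] with L hL
  rw [Function.comp_apply, Real.sinc_of_ne_zero (by positivity), sinHalf, div_div]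
  field_simp

theorem two_mul_add_one_le_mul_sinHalf {L j : ℕ} (hj : 2 * j + 1 ≤ L) :
    2 * (j : ℝ) + 1 ≤ L * sinHalf L j := by
  have hL : (0 : ℝ) < L := by exact_mod_cast (by omega : 0 < L)
  have hj' : 2 * (j : ℝ) + 1 ≤ L := by exact_mod_cast hj
  have hangle : (2 * j + 1) * Real.pi / (2 * L) ≤ Real.pi / 2 := by
    rw [div_le_div_iff₀ (by positivity) two_pos]
    nlinarith [Real.pi_pos]
  have hjordan := Real.mul_le_sin (by positivity) hangle
  rw [show 2 / Real.pi * ((2 * j + 1) * Real.pi / (2 * L)) = (2 * j + 1) / L by field_simp,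
    div_le_iff₀' hL] at hjordan
  exact hjordan

end SinHalf

section MomentumMean

/-- The mean of `f (sin (q / 2))` over the antiperiodic momenta `q`. -/
def momentumMean (f : ℝ → ℝ) (L : ℕ) : ℝ := (∑ j ∈ Finset.range L, f (sinHalf L j)) / L

/-- The mean of the `p`-th inverse powers of `sin (q / 2)` over the antiperiodic momenta `q`. -/
def invSinMean (p : ℕ) : ℕ → ℝ := momentumMean fun σ => σ⁻¹ ^ p

theorem momentumMean_mono {f g : ℝ → ℝ} (h : ∀ σ ∈ Set.Ioc (0 : ℝ) 1, f σ ≤ g σ) (L : ℕ) :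
    momentumMean f L ≤ momentumMean g L :=
  div_le_div_of_nonneg_right (Finset.sum_le_sum fun _ hj =>
    h _ (sinHalf_mem_Ioc (Finset.mem_range.1 hj))) L.cast_nonneg

theorem abs_momentumMean_le {f g : ℝ → ℝ} (h : ∀ σ ∈ Set.Ioc (0 : ℝ) 1, |f σ| ≤ g σ) (L : ℕ) :
    |momentumMean f L| ≤ momentumMean g L := by
  rw [momentumMean, abs_div, Nat.abs_cast]
  exact (div_le_div_of_nonneg_right (Finset.abs_sum_le_sum_abs _ _) L.cast_nonneg).trans
    (momentumMean_mono h L)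

theorem momentumMean_add_mul (f g : ℝ → ℝ) (c : ℝ) (L : ℕ) :
    momentumMean (fun σ => f σ + c * g σ) L = momentumMean f L + c * momentumMean g L := by
  simp only [momentumMean, Finset.sum_add_distrib, ← Finset.mul_sum]
  ring

theorem momentumMean_const_le {c : ℝ} (hc : 0 ≤ c) (L : ℕ) : momentumMean (fun _ => c) L ≤ c := by
  rw [momentumMean, Finset.sum_const, Finset.card_range, nsmul_eq_mul]
  exact div_le_of_le_mul₀ L.cast_nonneg hc (mul_comm _ _).le

theorem sum_inv_odd_le_invSinMean {p : ℕ} (hp : 1 ≤ p) (L : ℕ) :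
    2 / Real.pi * ∑ j ∈ Finset.range L, 1 / (2 * (j : ℝ) + 1) ≤ invSinMean p L := by
  have hmono : momentumMean (fun σ => σ⁻¹) L ≤ invSinMean p L := momentumMean_mono
    (fun σ hσ => le_self_pow₀ ((one_le_inv₀ hσ.1).2 hσ.2) (Nat.one_le_iff_ne_zero.1 hp)) L
  refine le_trans ?_ hmono
  rw [momentumMean, Finset.mul_sum, Finset.sum_div]
  refine Finset.sum_le_sum fun j hj => ?_
  have hj := Finset.mem_range.1 hj
  have hL : (0 : ℝ) < L := by exact_mod_cast j.zero_le.trans_lt hj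
  have hsin : sinHalf L j ≤ (2 * j + 1) * Real.pi / (2 * L) := Real.sin_le (by positivity)
  calc 2 / Real.pi * (1 / (2 * (j : ℝ) + 1)) = ((2 * j + 1) * Real.pi / (2 * L))⁻¹ / L := by
        field_simp
    _ ≤ (sinHalf L j)⁻¹ / L := by gcongr; exact sinHalf_pos hj

theorem tendsto_sum_inv_odd_atTop :
    Tendsto (fun n : ℕ => ∑ j ∈ Finset.range n, 1 / (2 * (j : ℝ) + 1)) atTop atTop := by
  refine tendsto_atTop_mono (fun n => ?_)
    (Real.tendsto_sum_range_one_div_nat_succ_atTop.const_mul_atTop (one_half_pos (α := ℝ)))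
  rw [Finset.mul_sum]
  refine Finset.sum_le_sum fun j _ => ?_
  rw [div_mul_div_comm, one_mul]
  exact one_div_le_one_div_of_le (by positivity) (by linarith)

theorem tendsto_invSinMean_atTop {p : ℕ} (hp : 1 ≤ p) : Tendsto (invSinMean p) atTop atTop :=
  tendsto_atTop_mono (sum_inv_odd_le_invSinMean hp)
    (tendsto_sum_inv_odd_atTop.const_mul_atTop (div_pos two_pos Real.pi_pos))

theorem exists_abs_sub_le_add_mul_pow {h : ℝ → ℝ} (hh : ContinuousOn h (Set.Icc 0 1)) {ε : ℝ}
    (hε : 0 < ε) (p : ℕ) : ∃ K, 0 ≤ K ∧ ∀ σ ∈ Set.Icc (0 : ℝ) 1, |h σ - h 0| ≤ ε + K * σ ^ p := by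
  obtain ⟨δ, hδ, hnear⟩ :=
    Metric.continuousWithinAt_iff.1 (hh 0 (Set.left_mem_Icc.2 zero_le_one)) ε hε
  obtain ⟨B, hB⟩ := isCompact_Icc.exists_bound_of_continuousOn (hh.sub continuousOn_const)
  have hB0 : 0 ≤ B := (norm_nonneg _).trans (hB 0 (Set.left_mem_Icc.2 zero_le_one))
  refine ⟨B / δ ^ p, by positivity, fun σ hσ => ?_⟩
  have hσ0 : 0 ≤ σ := hσ.1
  rcases lt_or_ge σ δ with hlt | hge
  · have hdist : dist σ 0 < δ := by rwa [Real.dist_0_eq_abs, abs_of_nonneg hσ0]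
    exact (hnear hσ hdist).le.trans (le_add_of_nonneg_right (by positivity))
  · calc |h σ - h 0| ≤ B := hB σ hσ
      _ = B / δ ^ p * δ ^ p := (div_mul_cancel₀ _ (by positivity)).symm
      _ ≤ B / δ ^ p * σ ^ p := by gcongr
      _ ≤ ε + B / δ ^ p * σ ^ p := le_add_of_nonneg_left hε.le

/- Since `invSinMean p` diverges, its weights concentrate at `σ = 0`. -/
theorem tendsto_weightedMean_div_invSinMean {h : ℝ → ℝ} (hh : ContinuousOn h (Set.Icc 0 1)) {p : ℕ}
    (hp : 1 ≤ p) : Tendsto (fun L => momentumMean (fun σ => σ⁻¹ ^ p * h σ) L / invSinMean p L)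
      atTop (𝓝 (h 0)) := by
  rw [Metric.tendsto_nhds]
  intro ε hε
  obtain ⟨K, hK, hbound⟩ := exists_abs_sub_le_add_mul_pow hh (half_pos hε) p
  have hlarge := (tendsto_invSinMean_atTop hp).eventually_gt_atTop (K / (ε / 2))
  filter_upwards [hlarge] with L hL
  have hpos : 0 < invSinMean p L := hL.trans_le' (by positivity)
  have hcenter : momentumMean (fun σ => σ⁻¹ ^ p * h σ) L - h 0 * invSinMean p L =
      momentumMean (fun σ => σ⁻¹ ^ p * h σ + -h 0 * σ⁻¹ ^ p) L := by
    rw [momentumMean_add_mul, ← invSinMean, neg_mul, sub_eq_add_neg]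
  have hdiff : |momentumMean (fun σ => σ⁻¹ ^ p * h σ) L - h 0 * invSinMean p L| ≤
      K + ε / 2 * invSinMean p L :=
    calc _ ≤ momentumMean (fun σ => K + ε / 2 * σ⁻¹ ^ p) L := by
          rw [hcenter]
          refine abs_momentumMean_le (fun σ hσ => ?_) L
          have hσ0 : 0 < σ := hσ.1
          rw [neg_mul, ← sub_eq_add_neg, mul_comm (h 0), ← mul_sub, abs_mul,
            abs_of_pos (by positivity : 0 < σ⁻¹ ^ p)]
          calc σ⁻¹ ^ p * |h σ - h 0| ≤ σ⁻¹ ^ p * (ε / 2 + K * σ ^ p) := by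
                gcongr; exact hbound σ (Set.Ioc_subset_Icc_self hσ)
            _ = K + ε / 2 * σ⁻¹ ^ p := by rw [inv_pow]; field_simp; ring
      _ ≤ K + ε / 2 * invSinMean p L := by
          rw [momentumMean_add_mul]
          gcongr
          exacts [momentumMean_const_le hK L, le_rfl]
  rw [div_lt_iff₀ (half_pos hε)] at hL
  rw [Real.dist_eq, div_sub' hpos.ne', abs_div, abs_of_pos hpos, div_lt_iff₀ hpos,
    mul_comm (invSinMean p L)]
  linarith

theorem tendsto_invSinMean_div_succ (p : ℕ) :
    Tendsto (fun L => invSinMean p L / invSinMean (p + 1) L) atTop (𝓝 0) := by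
  refine (tendsto_weightedMean_div_invSinMean continuousOn_id p.succ_pos).congr fun L => ?_
  congr 1
  refine congrArg (· / (L : ℝ)) (Finset.sum_congr rfl fun j hj => ?_)
  dsimp only [id]
  rw [Nat.succ_eq_add_one, pow_succ, mul_assoc,
    inv_mul_cancel₀ (sinHalf_pos (Finset.mem_range.1 hj)).ne', mul_one]

theorem tendsto_sum_inv_mul_sinHalf {p : ℕ} (hp : 2 ≤ p) {N : ℕ → ℕ} (hN : ∀ L, N L ≤ (L + 1) / 2)
    (hN' : Tendsto N atTop atTop) :
    Tendsto (fun L : ℕ => ∑ j ∈ Finset.range (N L), (L * sinHalf L j)⁻¹ ^ p) atTop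
      (𝓝 (∑' j : ℕ, (2 / ((2 * j + 1) * Real.pi)) ^ p)) := by
  have hsum : Summable fun j : ℕ => (1 / ((j : ℝ) + 1)) ^ p := by
    have := (summable_nat_add_iff 1).2 (Real.summable_one_div_nat_pow.2 (by omega : 1 < p))
    simpa [div_pow] using this
  have htsum (L : ℕ) : ∑' j : ℕ, (if j < N L then (L * sinHalf L j)⁻¹ ^ p else 0) =
      ∑ j ∈ Finset.range (N L), (L * sinHalf L j)⁻¹ ^ p := by
    rw [tsum_eq_sum (s := Finset.range (N L)) fun j hj => if_neg (by simpa using hj)]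
    exact Finset.sum_congr rfl fun j hj => if_pos (Finset.mem_range.1 hj)
  refine (tendsto_tsum_of_dominated_convergence hsum (fun j => ?_)
    (Eventually.of_forall fun L j => ?_)).congr htsum
  · have h := ((tendsto_mul_sinHalf j).inv₀ (by positivity)).pow p
    rw [inv_div] at h
    refine h.congr' ?_
    filter_upwards [hN'.eventually_gt_atTop j] with L hL
    rw [if_pos hL]
  · split_ifs with hj
    · have hle : 2 * j + 1 ≤ L := by have := hN L; omega
      have hjordan := two_mul_add_one_le_mul_sinHalf hle
      have hpos : 0 < L * sinHalf L j := lt_of_lt_of_le (by positivity) hjordan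
      rw [Real.norm_of_nonneg (by positivity), one_div]
      gcongr
      linarith [(Nat.cast_nonneg j : (0 : ℝ) ≤ j)]
    · rw [norm_zero]
      positivity

theorem tendsto_invSinMean_div_pow {p : ℕ} (hp : 1 ≤ p) :
    Tendsto (fun L : ℕ => invSinMean (p + 1) L / (L : ℝ) ^ p) atTop
      (𝓝 (2 * ∑' j : ℕ, (2 / ((2 * j + 1) * Real.pi)) ^ (p + 1))) := by
  have hupper := tendsto_sum_inv_mul_sinHalf (p := p + 1) (by omega) (N := fun L => (L + 1) / 2)
    (fun L => le_rfl) (tendsto_atTop_atTop.2 fun b => ⟨2 * b, fun a ha => by omega⟩)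
  have hlower := tendsto_sum_inv_mul_sinHalf (p := p + 1) (by omega) (N := fun L => L / 2)
    (fun L => by omega) (tendsto_atTop_atTop.2 fun b => ⟨2 * b, fun a ha => by omega⟩)
  rw [two_mul]
  refine (hupper.add hlower).congr fun L => ?_
  rw [invSinMean, momentumMean, ← sum_sinHalf_fold (fun x => (L * x)⁻¹ ^ (p + 1)), div_div,
    ← pow_succ', Finset.sum_div]
  refine Finset.sum_congr rfl fun j _ => ?_
  rw [mul_inv, mul_pow, inv_pow, mul_comm]
  rfl

theorem tendsto_invSinMean_div_pow_zero {p : ℕ} (hp : 1 ≤ p) :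
    Tendsto (fun L : ℕ => invSinMean p L / (L : ℝ) ^ p) atTop (𝓝 0) := by
  have h := (tendsto_invSinMean_div_succ p).mul (tendsto_invSinMean_div_pow hp)
  rw [zero_mul] at h
  refine h.congr' ?_
  filter_upwards [(tendsto_invSinMean_atTop p.succ_pos).eventually_gt_atTop 0] with L hL
  exact div_mul_div_cancel₀ hL.ne'

end MomentumMean

section OddZeta

theorem riemannZeta_natCast_re {p : ℕ} (hp : 2 ≤ p) :
    (riemannZeta p).re = ∑' n : ℕ, 1 / (n : ℝ) ^ p := by
  have hcast (n : ℕ) : (1 / (n : ℂ) ^ p) = ((1 / (n : ℝ) ^ p : ℝ) : ℂ) := by push_cast; rfl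
  rw [zeta_nat_eq_tsum_of_gt_one hp, tsum_congr hcast, ← Complex.ofReal_tsum, Complex.ofReal_re]

theorem tsum_one_div_odd_pow {p : ℕ} (hp : 2 ≤ p) :
    ∑' k : ℕ, 1 / ((2 * k + 1 : ℕ) : ℝ) ^ p =
      (1 - (1 / 2) ^ p) * ∑' n : ℕ, 1 / (n : ℝ) ^ p := by
  have hs : Summable fun n : ℕ => 1 / (n : ℝ) ^ p := Real.summable_one_div_nat_pow.2 hp
  have he : Summable fun k : ℕ => 1 / ((2 * k : ℕ) : ℝ) ^ p :=
    hs.comp_injective (i := fun k : ℕ => 2 * k) fun a b h => by simpa using h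
  have ho : Summable fun k : ℕ => 1 / ((2 * k + 1 : ℕ) : ℝ) ^ p :=
    hs.comp_injective (i := fun k : ℕ => 2 * k + 1) fun a b h => by simpa using h
  have hsplit := tsum_even_add_odd (f := fun n : ℕ => 1 / (n : ℝ) ^ p) he ho
  have heven : ∑' k : ℕ, 1 / ((2 * k : ℕ) : ℝ) ^ p = (1 / 2) ^ p * ∑' n : ℕ, 1 / (n : ℝ) ^ p := by
    rw [← tsum_mul_left]
    refine tsum_congr fun k => ?_
    rw [Nat.cast_mul, mul_pow, one_div_pow, one_div_mul_one_div, Nat.cast_ofNat]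
  linarith

theorem tsum_inv_odd_pow {p : ℕ} (hp : 2 ≤ p) :
    ∑' j : ℕ, (2 / ((2 * (j : ℝ) + 1) * Real.pi)) ^ p =
      (2 / Real.pi) ^ p * ((1 - (1 / 2) ^ p) * (riemannZeta p).re) := by
  rw [riemannZeta_natCast_re hp, ← tsum_one_div_odd_pow hp, ← tsum_mul_left]
  refine tsum_congr fun j => ?_
  rw [mul_comm _ Real.pi, ← div_div, div_eq_mul_one_div (2 / Real.pi), mul_pow, one_div_pow]
  norm_cast

end OddZeta

section Ladder

variable {L : ℕ}

theorem natCast_inj_of_lt {i j : ℕ} (hi : i < L) (hj : j < L) :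
    ((i : ZMod L) = (j : ZMod L)) ↔ i = j := by
  rw [ZMod.natCast_eq_natCast_iff', Nat.mod_eq_of_lt hi, Nat.mod_eq_of_lt hj]

/-- The configuration with the occupation number at the site `j` flipped. -/
def siteFlip (j : ℕ) (η : Config L) : Config L := Function.update η (j : ZMod L) (!η j)

/-- The Jordan–Wigner sign: the parity of the number of particles on the sites `0, …, k - 1`. -/
def jwSign (k : ℕ) (η : Config L) : ℝ :=
  ∏ i ∈ Finset.range k, if η (i : ZMod L) then (-1 : ℝ) else 1

theorem siteFlip_self (j : ℕ) (η : Config L) : siteFlip j η (j : ZMod L) = !η j := by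
  simp [siteFlip]

theorem siteFlip_of_ne {i j : ℕ} (hi : i < L) (hj : j < L) (h : i ≠ j) (η : Config L) :
    siteFlip j η (i : ZMod L) = η i := by
  simp [siteFlip, natCast_inj_of_lt hi hj, h]

theorem siteFlip_siteFlip (j : ℕ) (η : Config L) : siteFlip j (siteFlip j η) = η := by
  simp [siteFlip]

theorem siteFlip_comm {i j : ℕ} (hi : i < L) (hj : j < L) (h : i ≠ j) (η : Config L) :
    siteFlip i (siteFlip j η) = siteFlip j (siteFlip i η) := by
  have h1 : (i : ZMod L) ≠ j := fun e => h ((natCast_inj_of_lt hi hj).1 e)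
  simp only [siteFlip]
  rw [Function.update_of_ne h1, Function.update_of_ne h1.symm, Function.update_comm h1]

theorem jwSign_mul_self (k : ℕ) (η : Config L) : jwSign k η * jwSign k η = 1 := by
  rw [jwSign, ← Finset.prod_mul_distrib]
  exact Finset.prod_eq_one fun i _ => by split_ifs <;> norm_num

theorem jwSign_succ (k : ℕ) (η : Config L) :
    jwSign (k + 1) η = jwSign k η * if η (k : ZMod L) then (-1 : ℝ) else 1 := by
  rw [jwSign, Finset.prod_range_succ, jwSign]

theorem jwSign_siteFlip_of_le {k j : ℕ} (hk : k ≤ j) (hj : j < L) (η : Config L) :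
    jwSign k (siteFlip j η) = jwSign k η := by
  refine Finset.prod_congr rfl fun i hi => ?_
  have hi := Finset.mem_range.1 hi
  rw [siteFlip_of_ne (by omega) hj (by omega)]

theorem jwSign_siteFlip_of_lt {k j : ℕ} (hk : j < k) (hj : k ≤ L) (η : Config L) :
    jwSign k (siteFlip j η) = -jwSign k η := by
  induction k with
  | zero => omega
  | succ k ih =>
    rw [jwSign_succ, jwSign_succ]
    rcases Nat.lt_succ_iff_lt_or_eq.1 hk with h | rfl
    · rw [ih h (by omega), siteFlip_of_ne (by omega) (by omega) (by omega), neg_mul]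
    · rw [jwSign_siteFlip_of_le le_rfl (by omega), siteFlip_self]
      cases η (j : ZMod L) <;> simp

/-- The fermionic ladder operator at the site `k`: the creation operator for `b = true` and the
annihilation operator for `b = false`. -/
def ladder (k : ℕ) (b : Bool) : (Config L → ℝ) →ₗ[ℝ] (Config L → ℝ) where
  toFun f η := if η (k : ZMod L) = b then jwSign k η * f (siteFlip k η) else 0
  map_add' f g := by
    ext η
    simp only [Pi.add_apply]
    split_ifs <;> ring
  map_smul' c f := by
    ext η
    simp only [Pi.smul_apply, smul_eq_mul, RingHom.id_apply]
    split_ifs <;> ring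

theorem ladder_apply (k : ℕ) (b : Bool) (f : Config L → ℝ) (η : Config L) :
    ladder k b f η = if η (k : ZMod L) = b then jwSign k η * f (siteFlip k η) else 0 := rfl

theorem ladder_anticomm_of_lt {i j : ℕ} (hij : i < j) (hj : j < L) (b c : Bool)
    (f : Config L → ℝ) : ladder i b (ladder j c f) = -ladder j c (ladder i b f) := by
  ext η
  rw [Pi.neg_apply]
  simp only [ladder_apply]
  rw [siteFlip_of_ne hj (by omega) (by omega), siteFlip_of_ne (by omega) hj (by omega),
    jwSign_siteFlip_of_le hij.le hj, jwSign_siteFlip_of_lt hij hj.le,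
    siteFlip_comm (i := i) (j := j) (by omega) hj (by omega)]
  split_ifs <;> ring

theorem ladder_anticomm {i j : ℕ} (hi : i < L) (hj : j < L) (hij : i ≠ j) (b c : Bool)
    (f : Config L → ℝ) : ladder i b (ladder j c f) = -ladder j c (ladder i b f) := by
  rcases lt_or_gt_of_ne hij with h | h
  · exact ladder_anticomm_of_lt h hj b c f
  · rw [ladder_anticomm_of_lt h hi c b f, neg_neg]

theorem ladder_ladder_self (k : ℕ) (b : Bool) (f : Config L → ℝ) :
    ladder k b (ladder k b f) = 0 := by
  ext η
  simp only [ladder_apply, siteFlip_self]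
  cases b <;> cases η (k : ZMod L) <;> simp

theorem ladder_anticomm_same {i j : ℕ} (hi : i < L) (hj : j < L) (b : Bool) (f : Config L → ℝ) :
    ladder i b (ladder j b f) = -ladder j b (ladder i b f) := by
  rcases eq_or_ne i j with rfl | h
  · rw [ladder_ladder_self, neg_zero]
  · exact ladder_anticomm hi hj h b b f

theorem annihilation_creation {i j : ℕ} (hi : i < L) (hj : j < L) (f : Config L → ℝ) :
    ladder i false (ladder j true f) =
      -ladder j true (ladder i false f) + if i = j then f else 0 := by
  rcases eq_or_ne i j with rfl | h
  · ext η
    simp only [ladder_apply, siteFlip_self, siteFlip_siteFlip, if_true, Pi.add_apply, Pi.neg_apply]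
    have h := jwSign_mul_self i η
    rw [jwSign_siteFlip_of_le le_rfl hi]
    cases hη : η (i : ZMod L) <;> simp [← mul_assoc, h]
  · rw [ladder_anticomm hi hj h, if_neg h, add_zero]

theorem creation_annihilation_self {i : ℕ} (hi : i < L) (f : Config L → ℝ) (η : Config L) :
    ladder i true (ladder i false f) η = occ η i * f η := by
  simp only [ladder_apply, siteFlip_self, siteFlip_siteFlip, jwSign_siteFlip_of_le le_rfl hi,
    occ]
  have h := jwSign_mul_self i η
  cases hη : η (i : ZMod L) <;> simp [h, ← mul_assoc]

/-- The contraction of the annihilation operator at `i` with the pair creation operator at the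
sites `e`. -/
def contraction (i : ℕ) (e : ℕ × ℕ) : (Config L → ℝ) →ₗ[ℝ] (Config L → ℝ) :=
  (if i = e.1 then ladder e.2 true else 0) - (if i = e.2 then ladder e.1 true else 0)

theorem pair_creation_comm {i j k : ℕ} (hi : i < L) (hj : j < L) (hk : k < L)
    (f : Config L → ℝ) : ladder i true (ladder j true (ladder k true f)) =
      ladder j true (ladder k true (ladder i true f)) := by
  rw [ladder_anticomm_same hi hj, ladder_anticomm_same hi hk, map_neg, neg_neg]

theorem contraction_pair_creation {i j k : ℕ} {e : ℕ × ℕ} (h1 : e.1 < L) (h2 : e.2 < L)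
    (hj : j < L) (hk : k < L) (f : Config L → ℝ) :
    contraction i e (ladder j true (ladder k true f)) =
      ladder j true (ladder k true (contraction i e f)) := by
  unfold contraction
  split_ifs <;> simp [pair_creation_comm, h1, h2, hj, hk]

theorem contraction_pair_creation_self {i j k : ℕ} (hj : j < L) (hk : k < L) (f : Config L → ℝ) :
    contraction i (j, k) (ladder j true (ladder k true f)) = 0 := by
  unfold contraction
  have h1 : ladder j true (ladder j true (ladder k true f)) = 0 := ladder_ladder_self _ _ _
  have h2 : ladder k true (ladder j true (ladder k true f)) = 0 := by
    rw [ladder_anticomm_same hk hj, ladder_ladder_self, map_zero, neg_zero]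
  split_ifs <;> simp [h1, h2]

theorem annihilation_pair_creation {i j k : ℕ} (hi : i < L) (hj : j < L) (hk : k < L)
    (f : Config L → ℝ) : ladder i false (ladder j true (ladder k true f)) =
      ladder j true (ladder k true (ladder i false f)) + contraction i (j, k) f := by
  rw [annihilation_creation hi hj, annihilation_creation hi hk, contraction]
  split_ifs <;> simp <;> abel

theorem continuous_ladder {X : Type*} [TopologicalSpace X] {φ : X → Config L → ℝ}
    (hφ : ∀ η, Continuous fun x => φ x η) (k : ℕ) (b : Bool) (η : Config L) :
    Continuous fun x => ladder k b (φ x) η := by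
  simp only [ladder_apply]
  split_ifs
  · exact continuous_const.mul (hφ _)
  · exact continuous_const

theorem jwSign_emptyConfig (k : ℕ) : jwSign k (emptyConfig L) = 1 := by
  simp [jwSign, emptyConfig]

theorem annihilation_emptyConfig (k : ℕ) :
    ladder k false (Set.indicator {emptyConfig L} 1) = 0 := by
  ext η
  rw [ladder_apply, Pi.zero_apply]
  split_ifs with h
  · rw [Set.indicator_of_notMem, mul_zero]
    intro hempty
    rw [Set.mem_singleton_iff] at hempty
    simpa [siteFlip_self, h, emptyConfig] using congrFun hempty (k : ZMod L)
  · rfl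

/-- The unnormalised pair (BCS) state `∏ (1 + G e C_{e.1} C_{e.2}) |∅⟩` with amplitudes `G`, where
`C_k` is the creation operator `ladder k true` and `e` runs over `l`. The factors commute, so only
the multiset underlying the list `l` matters. -/
def pairState (L : ℕ) (G : ℕ × ℕ → ℝ) : List (ℕ × ℕ) → Config L → ℝ
  | [] => Set.indicator {emptyConfig L} 1
  | e :: l => pairState L G l + G e • ladder e.1 true (ladder e.2 true (pairState L G l))

theorem continuous_pairState {X : Type*} [TopologicalSpace X] {G : X → ℕ × ℕ → ℝ}
    (hG : ∀ e, Continuous fun x => G x e) (l : List (ℕ × ℕ)) (η : Config L) :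
    Continuous fun x => pairState L (G x) l η := by
  induction l generalizing η with
  | nil => exact continuous_const
  | cons e l ih =>
    exact (ih η).add ((hG e).mul (continuous_ladder (continuous_ladder ih _ _) _ _ _))

theorem pairState_emptyConfig (G : ℕ × ℕ → ℝ) (l : List (ℕ × ℕ)) :
    pairState L G l (emptyConfig L) = 1 := by
  induction l with
  | nil => simp [pairState]
  | cons e l ih => simp [pairState, ih, ladder_apply, emptyConfig]

theorem pairState_eq_zero_of_jwSign_ne_one (G : ℕ × ℕ → ℝ) {l : List (ℕ × ℕ)}
    (hl : ∀ e ∈ l, e.1 < L ∧ e.2 < L) {η : Config L} (hη : jwSign L η ≠ 1) :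
    pairState L G l η = 0 := by
  induction l generalizing η with
  | nil =>
    refine Set.indicator_of_notMem ?_ _
    rintro rfl
    exact hη (jwSign_emptyConfig L)
  | cons e l ih =>
    rw [List.forall_mem_cons] at hl
    have hflip : jwSign L (siteFlip e.2 (siteFlip e.1 η)) ≠ 1 := by
      rwa [jwSign_siteFlip_of_lt hl.1.2 le_rfl, jwSign_siteFlip_of_lt hl.1.1 le_rfl, neg_neg]
    simp [pairState, ih hl.2 hη, ladder_apply, ih hl.2 hflip]

theorem sum_contraction_pair_creation (G : ℕ × ℕ → ℝ) {l : List (ℕ × ℕ)}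
    (hl : ∀ e ∈ l, e.1 < L ∧ e.2 < L) {i j k : ℕ} (hj : j < L) (hk : k < L) (f : Config L → ℝ) :
    (l.map fun e => G e • contraction i e).sum (ladder j true (ladder k true f)) =
      ladder j true (ladder k true ((l.map fun e => G e • contraction i e).sum f)) := by
  induction l with
  | nil => simp
  | cons e l ih =>
    rw [List.forall_mem_cons] at hl
    simp only [List.map_cons, List.sum_cons, LinearMap.add_apply, LinearMap.smul_apply, map_add,
      map_smul, ih hl.2, contraction_pair_creation hl.1.1 hl.1.2 hj hk]

theorem annihilation_pairState (G : ℕ × ℕ → ℝ) {l : List (ℕ × ℕ)}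
    (hl : ∀ e ∈ l, e.1 < L ∧ e.2 < L) {i : ℕ} (hi : i < L) :
    ladder i false (pairState L G l) =
      (l.map fun e => G e • contraction i e).sum (pairState L G l) := by
  induction l with
  | nil => simp [pairState, annihilation_emptyConfig]
  | cons e l ih =>
    rw [List.forall_mem_cons] at hl
    obtain ⟨⟨hj, hk⟩, hl⟩ := hl
    simp only [pairState, List.map_cons, List.sum_cons, LinearMap.add_apply, LinearMap.smul_apply,
      map_add, map_smul, annihilation_pair_creation hi hj hk, ih hl,
      sum_contraction_pair_creation G hl hj hk, contraction_pair_creation_self hj hk, smul_zero,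
      smul_add]
    abel

end Ladder

theorem sum_cos_eq_zero {L : ℕ} (φ : ℝ) {d : ℤ} (hd : ¬(L : ℤ) ∣ d) :
    ∑ k ∈ Finset.range L, Real.cos (φ + 2 * Real.pi * d * k / L) = 0 := by
  rcases Nat.eq_zero_or_pos L with rfl | hL
  · simp
  have hL' : (L : ℝ) ≠ 0 := by positivity
  have hs : Real.sin (Real.pi * d / L) ≠ 0 := by
    intro h
    obtain ⟨n, hn⟩ := Real.sin_eq_zero_iff.1 h
    rw [eq_div_iff hL'] at hn
    have h2 : (n : ℝ) * L = d := mul_right_cancel₀ Real.pi_ne_zero (by linarith)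
    exact hd ⟨n, by rw [mul_comm]; exact_mod_cast h2.symm⟩
  have htele := Finset.sum_range_sub
    (fun k : ℕ => Real.sin (φ + 2 * Real.pi * d * k / L - Real.pi * d / L)) L
  have hstep : ∀ k : ℕ, Real.sin (φ + 2 * Real.pi * d * (k + 1 : ℕ) / L - Real.pi * d / L) -
      Real.sin (φ + 2 * Real.pi * d * k / L - Real.pi * d / L) =
      2 * Real.sin (Real.pi * d / L) * Real.cos (φ + 2 * Real.pi * d * k / L) := by
    intro k
    rw [Real.sin_sub_sin]
    congr 2
    · congr 1; push_cast; ring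
    · push_cast; ring
  simp only [hstep] at htele
  rw [← Finset.mul_sum, show φ + 2 * Real.pi * d * L / L - Real.pi * d / L =
    φ + 2 * Real.pi * d * (0 : ℕ) / L - Real.pi * d / L + d * (2 * Real.pi) by
      rw [mul_div_assoc, div_self hL']; push_cast; ring, Real.sin_add_int_mul_two_pi, sub_self]
    at htele
  exact (mul_eq_zero.1 htele).resolve_left (mul_ne_zero two_ne_zero hs)

theorem sum_cos_eq_ite {L : ℕ} (hL : 0 < L) (φ : ℝ) (d : ℤ) :
    ∑ k ∈ Finset.range L, Real.cos (φ + 2 * Real.pi * d * k / L) =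
      if (L : ℤ) ∣ d then L * Real.cos φ else 0 := by
  split_ifs with h
  · obtain ⟨c, rfl⟩ := h
    have hperiod (k : ℕ) :
        Real.cos (φ + 2 * Real.pi * ((L * c : ℤ) : ℝ) * k / L) = Real.cos φ := by
      rw [← Real.cos_add_int_mul_two_pi φ (c * k)]
      congr 2
      push_cast
      field_simp
    simp only [hperiod, Finset.sum_const, Finset.card_range, nsmul_eq_mul]
  · exact sum_cos_eq_zero φ h

/-- The antiperiodic Kronecker symbol as a Fourier sum over the antiperiodic momenta. -/
def antiDelta (L : ℕ) (x : ℤ) : ℝ :=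
  (∑ j ∈ Finset.range L, Real.cos (momentum L j * x)) / L

theorem momentum_mul_self {L : ℕ} (hL : 0 < L) (j : ℕ) :
    momentum L j * L = (2 * j + 1) * Real.pi := by
  have : (L : ℝ) ≠ 0 := by positivity
  unfold momentum; field_simp

theorem cos_momentum_mul_add {L : ℕ} (hL : 0 < L) (j : ℕ) (x : ℤ) :
    Real.cos (momentum L j * ((x + L : ℤ) : ℝ)) = -Real.cos (momentum L j * x) := by
  push_cast
  rw [mul_add, momentum_mul_self hL, show momentum L j * x + (2 * j + 1) * Real.pi =
    momentum L j * x + Real.pi + j * (2 * Real.pi) by ring, Real.cos_add_nat_mul_two_pi,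
    Real.cos_add_pi]

theorem sin_momentum_mul_add {L : ℕ} (hL : 0 < L) (j : ℕ) (x : ℤ) :
    Real.sin (momentum L j * ((x + L : ℤ) : ℝ)) = -Real.sin (momentum L j * x) := by
  push_cast
  rw [mul_add, momentum_mul_self hL, show momentum L j * x + (2 * j + 1) * Real.pi =
    momentum L j * x + Real.pi + j * (2 * Real.pi) by ring, Real.sin_add_nat_mul_two_pi,
    Real.sin_add_pi]

theorem antiDelta_zero {L : ℕ} (hL : 0 < L) : antiDelta L 0 = 1 := by
  have : (L : ℝ) ≠ 0 := by positivity
  simp [antiDelta, this]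

theorem antiDelta_add {L : ℕ} (hL : 0 < L) (x : ℤ) : antiDelta L (x + L) = -antiDelta L x := by
  simp only [antiDelta, cos_momentum_mul_add hL, Finset.sum_neg_distrib, neg_div]

theorem antiDelta_eq_zero {L : ℕ} {x : ℤ} (hx : ¬(L : ℤ) ∣ x) : antiDelta L x = 0 := by
  rw [antiDelta, div_eq_zero_iff]
  left
  rw [← sum_cos_eq_zero (Real.pi * x / L) hx]
  refine Finset.sum_congr rfl fun j _ => ?_
  congr 1
  unfold momentum
  ring

/-- The function on `ℤ` with sine coefficients `c j` at the antiperiodic momenta. -/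
def sineSum (L : ℕ) (c : ℕ → ℝ) (x : ℤ) : ℝ :=
  (∑ j ∈ Finset.range L, c j * Real.sin (momentum L j * x)) / L

theorem sineSum_neg (L : ℕ) (c : ℕ → ℝ) (x : ℤ) : sineSum L c (-x) = -sineSum L c x := by
  simp [sineSum, neg_div]

theorem sineSum_add {L : ℕ} (hL : 0 < L) (c : ℕ → ℝ) (x : ℤ) :
    sineSum L c (x + L) = -sineSum L c x := by
  simp only [sineSum, sin_momentum_mul_add hL, mul_neg, Finset.sum_neg_distrib, neg_div]

theorem momentum_reflect {L j : ℕ} (h : j < L) :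
    momentum L (L - 1 - j) = 2 * Real.pi - momentum L j := by
  have hL : (L : ℝ) ≠ 0 := by have : 0 < L := by omega
                              positivity
  unfold momentum
  rw [Nat.cast_sub (by omega), Nat.cast_sub (by omega)]
  field_simp
  push_cast
  ring

theorem dvd_sub_iff_eq {L i j : ℕ} (hi : i < L) (hj : j < L) : (L : ℤ) ∣ i - j ↔ i = j := by
  refine ⟨fun h => ?_, by rintro rfl; simp⟩
  have := Int.eq_zero_of_abs_lt_dvd h (by rw [abs_lt]; omega)
  omega

theorem dvd_add_add_one_iff {L i j : ℕ} (hi : i < L) (hj : j < L) :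
    (L : ℤ) ∣ i + j + 1 ↔ j = L - 1 - i := by
  have h := dvd_sub_iff_eq hj (show L - 1 - i < L by omega)
  rwa [← dvd_add_self_right, show (j : ℤ) - (L - 1 - i : ℕ) + L = i + j + 1 by omega] at h

theorem sum_sin_mul_sin {L i j : ℕ} (hi : i < L) (hj : j < L) (m n : ℤ) :
    ∑ k ∈ Finset.range L, Real.sin (momentum L i * ((k - m : ℤ) : ℝ))
      * Real.sin (momentum L j * ((k - n : ℤ) : ℝ)) =
    L / 2 * ((if i = j then Real.cos (momentum L i * ((m - n : ℤ) : ℝ)) else 0)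
      - (if j = L - 1 - i then Real.cos (momentum L i * ((m - n : ℤ) : ℝ)) else 0)) := by
  have hL : 0 < L := by omega
  have hprod (k : ℕ) : Real.sin (momentum L i * ((k - m : ℤ) : ℝ))
      * Real.sin (momentum L j * ((k - n : ℤ) : ℝ)) =
      1 / 2 * (Real.cos (momentum L j * n - momentum L i * m
          + 2 * Real.pi * ((i - j : ℤ) : ℝ) * k / L) -
        Real.cos (-momentum L j * n - momentum L i * m
          + 2 * Real.pi * ((i + j + 1 : ℤ) : ℝ) * k / L)) := by
    rw [show momentum L j * n - momentum L i * m + 2 * Real.pi * ((i - j : ℤ) : ℝ) * k / L =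
        momentum L i * ((k - m : ℤ) : ℝ) - momentum L j * ((k - n : ℤ) : ℝ) by
          unfold momentum; push_cast; ring,
      show -momentum L j * n - momentum L i * m + 2 * Real.pi * ((i + j + 1 : ℤ) : ℝ) * k / L =
        momentum L i * ((k - m : ℤ) : ℝ) + momentum L j * ((k - n : ℤ) : ℝ) by
          unfold momentum; push_cast; ring, Real.cos_sub, Real.cos_add]
    ring
  have hdiff (h : i = j) : Real.cos (momentum L j * n - momentum L i * m) =
      Real.cos (momentum L i * ((m - n : ℤ) : ℝ)) := by
    rw [← h, ← Real.cos_neg]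
    congr 1
    push_cast
    ring
  have hsum (h : j = L - 1 - i) : Real.cos (-momentum L j * n - momentum L i * m) =
      Real.cos (momentum L i * ((m - n : ℤ) : ℝ)) := by
    rw [h, momentum_reflect hi, ← Real.cos_neg, ← Real.cos_sub_int_mul_two_pi _ n]
    congr 1
    push_cast
    ring
  simp only [hprod, ← Finset.mul_sum, Finset.sum_sub_distrib, sum_cos_eq_ite hL,
    dvd_sub_iff_eq hi hj, dvd_add_add_one_iff hi hj]
  split_ifs with hij hji hji
  · rw [hdiff hij, hsum hji]; ring
  · rw [hdiff hij]; ring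
  · rw [hsum hji]; ring
  · ring

theorem sum_sineSum_mul {L : ℕ} (hL : 0 < L) {c : ℕ → ℝ}
    (hc : ∀ j < L, c (L - 1 - j) = -c j) (m n : ℤ) :
    ∑ k ∈ Finset.range L, sineSum L c (k - m) * sineSum L c (k - n) =
      (∑ j ∈ Finset.range L, c j ^ 2 * Real.cos (momentum L j * ((m - n : ℤ) : ℝ))) / L := by
  have hL' : (L : ℝ) ≠ 0 := by positivity
  have hexpand : ∀ k : ℕ, sineSum L c (k - m) * sineSum L c (k - n) =
      (∑ i ∈ Finset.range L, ∑ j ∈ Finset.range L, c i * c j *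
        (Real.sin (momentum L i * ((k - m : ℤ) : ℝ))
          * Real.sin (momentum L j * ((k - n : ℤ) : ℝ)))) / L ^ 2 := by
    intro k
    rw [sineSum, sineSum, div_mul_div_comm, Finset.sum_mul_sum, ← pow_two]
    congr 1
    exact Finset.sum_congr rfl fun i _ => Finset.sum_congr rfl fun j _ => by ring
  simp only [hexpand]
  rw [← Finset.sum_div, Finset.sum_comm, div_eq_div_iff (by positivity) hL', Finset.sum_mul,
    Finset.sum_mul]
  refine Finset.sum_congr rfl fun i hi => ?_
  have hi := Finset.mem_range.1 hi
  rw [Finset.sum_comm]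
  have horth : ∀ j ∈ Finset.range L, ∑ k ∈ Finset.range L, c i * c j *
        (Real.sin (momentum L i * ((k - m : ℤ) : ℝ))
          * Real.sin (momentum L j * ((k - n : ℤ) : ℝ))) =
      (if i = j then c i * c j * (L / 2) * Real.cos (momentum L i * ((m - n : ℤ) : ℝ)) else 0) -
      (if j = L - 1 - i then c i * c j * (L / 2) * Real.cos (momentum L i * ((m - n : ℤ) : ℝ))
        else 0) := by
    intro j hj
    rw [← Finset.mul_sum, sum_sin_mul_sin hi (Finset.mem_range.1 hj)]
    split_ifs <;> ring
  rw [Finset.sum_congr rfl horth, Finset.sum_sub_distrib, Finset.sum_ite_eq, Finset.sum_ite_eq',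
    if_pos (Finset.mem_range.2 hi), if_pos (Finset.mem_range.2 (by omega)), hc i hi]
  ring

/-- The pair amplitude in momentum space. -/
def pairCoeff (w μ z q : ℝ) : ℝ :=
  (μ + 2 * w * z) * Real.sin q /
    (Real.sqrt (dispersion w μ z q) - ((μ + w * z) * Real.cos q - w))

theorem pairCoeff_reflect (w μ z : ℝ) {L j : ℕ} (h : j < L) :
    pairCoeff w μ z (momentum L (L - 1 - j)) = -pairCoeff w μ z (momentum L j) := by
  rw [momentum_reflect h, pairCoeff, pairCoeff, dispersion, dispersion, Real.cos_two_pi_sub,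
    Real.sin_two_pi_sub, neg_sq, mul_neg, neg_div]

theorem cos_momentum_lt_one {L j : ℕ} (h : j < L) : Real.cos (momentum L j) < 1 := by
  have hs := sinHalf_pos h
  rw [sinHalf_eq] at hs
  have hcos := Real.cos_two_mul' (momentum L j / 2)
  rw [mul_div_cancel₀ _ two_ne_zero, Real.cos_sq'] at hcos
  nlinarith

theorem pairCoeff_denom_pos {w μ z q : ℝ} (hμ : 0 < μ) (hw : 0 < w) (hz : 0 ≤ z)
    (hq : Real.cos q < 1) :
    0 < Real.sqrt (dispersion w μ z q) - ((μ + w * z) * Real.cos q - w) := by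
  rw [sub_pos]
  have hwz : 0 ≤ w * z := by positivity
  rcases eq_or_ne (Real.sin q) 0 with h | h
  · have hc : Real.cos q = -1 := by
      have := Real.sin_sq_add_cos_sq q
      rw [h] at this
      nlinarith
    rw [hc]
    have := Real.sqrt_nonneg (dispersion w μ z q)
    linarith
  · refine Real.lt_sqrt_of_sq_lt ?_
    rw [dispersion]
    have : 0 < Real.sin q ^ 2 := by positivity
    have : 0 < μ * (μ + 2 * w * z) * Real.sin q ^ 2 := by positivity
    linarith

theorem dispersion_nonneg {w μ z : ℝ} (hμ : 0 < μ) (hw : 0 < w) (hz : 0 ≤ z) (q : ℝ) :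
    0 ≤ dispersion w μ z q := by
  unfold dispersion; positivity

theorem pairCoeff_mul_sin {w μ z q : ℝ} (hμ : 0 < μ) (hw : 0 < w) (hz : 0 ≤ z)
    (hq : Real.cos q < 1) :
    μ * (pairCoeff w μ z q * Real.sin q) =
      Real.sqrt (dispersion w μ z q) + ((μ + w * z) * Real.cos q - w) := by
  have hd := pairCoeff_denom_pos hμ hw hz hq
  have hs := Real.sq_sqrt (dispersion_nonneg hμ hw hz q)
  rw [pairCoeff, div_mul_eq_mul_div, mul_div_assoc', div_eq_iff hd.ne']
  have hdef : dispersion w μ z q = ((μ + w * z) * Real.cos q - w) ^ 2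
    + μ * (μ + 2 * w * z) * Real.sin q ^ 2 := rfl
  linear_combination -hs - hdef

theorem pairCoeff_riccati {w μ z q : ℝ} (hμ : 0 < μ) (hw : 0 < w) (hz : 0 ≤ z)
    (hq : Real.cos q < 1) :
    μ * pairCoeff w μ z q ^ 2 * Real.sin q =
      (μ + 2 * w * z) * Real.sin q + pairCoeff w μ z q * (2 * ((μ + w * z) * Real.cos q - w)) := by
  have hd := pairCoeff_denom_pos hμ hw hz hq
  have h := pairCoeff_mul_sin hμ hw hz hq
  have h2 : pairCoeff w μ z q * (Real.sqrt (dispersion w μ z q) -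
      ((μ + w * z) * Real.cos q - w)) = (μ + 2 * w * z) * Real.sin q := by
    rw [pairCoeff, div_mul_cancel₀ _ hd.ne']
  linear_combination pairCoeff w μ z q * h + h2

/-- The pair amplitude in position space. -/
def pairAmplitude (w μ : ℝ) (L : ℕ) (z : ℝ) (x : ℤ) : ℝ :=
  sineSum L (fun j => pairCoeff w μ z (momentum L j)) x

theorem continuous_pairAmplitude {w μ : ℝ} (hμ : 0 < μ) (hw : 0 < w) (L : ℕ) (x : ℤ) :
    Continuous fun z : Set.Ioc (0 : ℝ) 1 => pairAmplitude w μ L z x := by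
  unfold pairAmplitude sineSum
  refine (continuous_finsetSum _ fun j hj => ?_).div_const _
  refine Continuous.mul ?_ continuous_const
  unfold pairCoeff
  refine Continuous.div (by fun_prop) (by unfold dispersion; fun_prop) fun z => ?_
  exact (pairCoeff_denom_pos hμ hw z.2.1.le (cos_momentum_lt_one (Finset.mem_range.1 hj))).ne'

theorem sum_cos_momentum {L : ℕ} (hL : 2 ≤ L) :
    ∑ j ∈ Finset.range L, Real.cos (momentum L j) = 0 := by
  have hL' : (L : ℝ) ≠ 0 := by positivity
  have h := antiDelta_eq_zero (L := L) (x := 1) fun h => by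
    have := Int.le_of_dvd one_pos h
    omega
  rw [antiDelta, div_eq_zero_iff] at h
  simpa using h.resolve_right hL'

theorem topEigenvalue_eq_pairAmplitude {w μ z : ℝ} (hμ : 0 < μ) (hw : 0 < w) (hz : 0 ≤ z)
    {L : ℕ} (hL : 2 ≤ L) :
    topEigenvalue w μ L z = -(μ * L) + μ * (L * pairAmplitude w μ L z 1) := by
  have hL' : (L : ℝ) ≠ 0 := by positivity
  rw [pairAmplitude, sineSum, mul_div_cancel₀ _ hL', Finset.mul_sum]
  simp only [Int.cast_one, mul_one]
  rw [Finset.sum_congr rfl fun j hj => pairCoeff_mul_sin hμ hw hz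
    (cos_momentum_lt_one (Finset.mem_range.1 hj)), Finset.sum_add_distrib, Finset.sum_sub_distrib,
    ← Finset.mul_sum, sum_cos_momentum hL, topEigenvalue]
  simp
  ring

/-- The convolution of the pair amplitude with itself, by Fourier inversion: see
`sum_pairAmplitude_mul`. -/
def pairConvolution (w μ : ℝ) (L : ℕ) (z : ℝ) (x : ℤ) : ℝ :=
  (∑ j ∈ Finset.range L, pairCoeff w μ z (momentum L j) ^ 2
    * Real.cos (momentum L j * ((x - 1 : ℤ) : ℝ))) / L

theorem sum_pairAmplitude_mul (w μ z : ℝ) {L : ℕ} (hL : 0 < L) (m n : ℕ) :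
    ∑ k ∈ Finset.range L, pairAmplitude w μ L z (m - k) * pairAmplitude w μ L z (n - (k + 1 : ℕ)) =
      pairConvolution w μ L z (n - m) := by
  have hreflect (k : ℕ) :
      pairAmplitude w μ L z (m - k) * pairAmplitude w μ L z (n - (k + 1 : ℕ)) =
        sineSum L (fun j => pairCoeff w μ z (momentum L j)) (k - m) *
        sineSum L (fun j => pairCoeff w μ z (momentum L j)) (k - (n - 1)) := by
    rw [pairAmplitude, pairAmplitude, ← neg_mul_neg, ← sineSum_neg, ← sineSum_neg]
    congr 2 <;> push_cast <;> ring
  simp only [hreflect]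
  rw [pairConvolution, sum_sineSum_mul hL fun j hj => pairCoeff_reflect w μ z hj]
  congr 1
  refine Finset.sum_congr rfl fun j _ => ?_
  rw [← Real.cos_neg]
  congr 2
  push_cast
  ring

/-- The coefficient of `C_m C_n` with `n - m = x` in the tilted generator applied to the pair
state. The pair creation operators `C_m C_n` being antisymmetric in `m` and `n`, only its odd part
matters. -/
def pairResidual (w μ : ℝ) (L : ℕ) (z : ℝ) : ℤ → ℝ :=
  -μ • pairConvolution w μ L z + (μ + 2 * w * z) • (fun x => antiDelta L (x - 1))
    + (μ + w * z) •
      ((fun x => pairAmplitude w μ L z (x - 1)) + fun x => pairAmplitude w μ L z (x + 1))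
    - (2 * w) • pairAmplitude w μ L z

theorem pairResidual_neg {w μ z : ℝ} (hμ : 0 < μ) (hw : 0 < w) (hz : 0 ≤ z) (L : ℕ) (x : ℤ) :
    pairResidual w μ L z (-x) = pairResidual w μ L z x := by
  simp only [pairResidual, Pi.add_apply, Pi.sub_apply, Pi.smul_apply, smul_eq_mul, pairConvolution,
    antiDelta, pairAmplitude, sineSum]
  rw [← sub_eq_zero]
  simp only [← mul_div_assoc, Finset.mul_sum, ← add_div, ← sub_div, ← Finset.sum_add_distrib,
    ← Finset.sum_sub_distrib]
  rw [Finset.sum_eq_zero, zero_div]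
  intro j hj
  have hr := pairCoeff_riccati hμ hw hz (cos_momentum_lt_one (Finset.mem_range.1 hj))
  set q := momentum L j
  have e1 : q * ((-x - 1 : ℤ) : ℝ) = -(q * x + q) := by push_cast; ring
  have e2 : q * ((-x + 1 : ℤ) : ℝ) = -(q * x - q) := by push_cast; ring
  have e3 : q * ((-x : ℤ) : ℝ) = -(q * x) := by push_cast; ring
  have e4 : q * ((x - 1 : ℤ) : ℝ) = q * x - q := by push_cast; ring
  have e5 : q * ((x + 1 : ℤ) : ℝ) = q * x + q := by push_cast; ring
  rw [e1, e2, e3, e4, e5]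
  simp only [Real.cos_neg, Real.sin_neg, Real.cos_add, Real.cos_sub, Real.sin_add, Real.sin_sub]
  linear_combination 2 * Real.sin (q * x) * hr

section Eigenvector

variable {L : ℕ}

/-- The tilted generator with fugacity `z = exp s` acting on functions of the configuration. -/
def tiltedGen (w μ : ℝ) (L : ℕ) (z : ℝ) (f : Config L → ℝ) (η : Config L) : ℝ :=
  ∑ k ∈ Finset.range L,
    ((μ + w * z * (occ η (k : ZMod L) + occ η ((k : ZMod L) + 1))) * f (flip (k : ZMod L) η)
      - rate w μ η (k : ZMod L) * f η)

/-- The ladder operators continued antiperiodically to the site `L`. -/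
def antiLadder (k : ℕ) (b : Bool) : (Config L → ℝ) →ₗ[ℝ] (Config L → ℝ) :=
  if k = L then -ladder 0 b else ladder k b

theorem antiLadder_of_lt {k : ℕ} (hk : k < L) (b : Bool) :
    (antiLadder k b : (Config L → ℝ) →ₗ[ℝ] _) = ladder k b :=
  if_neg hk.ne

theorem antiLadder_self (b : Bool) :
    (antiLadder L b : (Config L → ℝ) →ₗ[ℝ] _) = -ladder 0 b :=
  if_pos rfl

theorem flip_eq_siteFlip {k l : ℕ} (hk : k < L) (hl : l < L) (hkl : k ≠ l)
    (h : (l : ZMod L) = (k : ZMod L) + 1) (η : Config L) :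
    flip (k : ZMod L) η = siteFlip l (siteFlip k η) := by
  have hne : (l : ZMod L) ≠ k := fun e => hkl ((natCast_inj_of_lt hl hk).1 e).symm
  funext j
  simp only [flip, siteFlip, ← h]
  rcases eq_or_ne j l with rfl | h1
  · simp [hne]
  · rcases eq_or_ne j k with rfl | h2
    · simp [h1]
    · simp [h1, h2]

theorem flipTerm_eq_ladder_of_lt {k : ℕ} (hk : k + 1 < L) (w μ z : ℝ) (f : Config L → ℝ)
    (η : Config L) :
    (μ + w * z * (occ η (k : ZMod L) + occ η ((k : ZMod L) + 1))) * f (flip (k : ZMod L) η) =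
      μ * ladder (k + 1) false (ladder k false f) η
      + (μ + 2 * w * z) * ladder k true (ladder (k + 1) true f) η
      + (μ + w * z) * (ladder k true (ladder (k + 1) false f) η
        + ladder (k + 1) true (ladder k false f) η) := by
  have hc : ((k + 1 : ℕ) : ZMod L) = (k : ZMod L) + 1 := by push_cast; rfl
  rw [flip_eq_siteFlip (by omega) hk (by omega) hc, ← hc]
  simp only [ladder_apply, occ]
  rw [siteFlip_of_ne (i := k) (j := k + 1) (by omega) hk (by omega),
    siteFlip_of_ne (i := k + 1) (j := k) hk (by omega) (by omega),
    jwSign_siteFlip_of_lt (k := k + 1) (j := k) (by omega) hk.le,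
    jwSign_siteFlip_of_le (k := k) (j := k + 1) (by omega) hk,
    siteFlip_comm (i := k) (j := k + 1) (by omega) hk (by omega), jwSign_succ]
  have h := jwSign_mul_self k η
  cases h1 : η (k : ZMod L) <;> cases h2 : η ((k + 1 : ℕ) : ZMod L) <;>
    simp only [Bool.false_eq_true, Bool.true_eq_false, if_true, if_false, mul_zero, mul_one,
      mul_neg, neg_mul]
  · linear_combination -μ * f (siteFlip (k + 1) (siteFlip k η)) * h
  · linear_combination -(μ + w * z) * f (siteFlip (k + 1) (siteFlip k η)) * h
  · linear_combination -(μ + w * z) * f (siteFlip (k + 1) (siteFlip k η)) * h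
  · linear_combination -(μ + 2 * w * z) * f (siteFlip (k + 1) (siteFlip k η)) * h

theorem flipTerm_eq_ladder_last {k : ℕ} (hL : 2 ≤ L) (hk : k + 1 = L) (w μ z : ℝ) {f : Config L → ℝ}
    (hf : ∀ η, jwSign L η ≠ 1 → f η = 0) (η : Config L) :
    (μ + w * z * (occ η (k : ZMod L) + occ η ((k : ZMod L) + 1))) * f (flip (k : ZMod L) η) =
      -μ * ladder 0 false (ladder k false f) η
      - (μ + 2 * w * z) * ladder k true (ladder 0 true f) η
      - (μ + w * z) * (ladder k true (ladder 0 false f) η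
        + ladder 0 true (ladder k false f) η) := by
  have hc : ((0 : ℕ) : ZMod L) = (k : ZMod L) + 1 := by
    rw [← Nat.cast_add_one, hk, ZMod.natCast_self, Nat.cast_zero]
  rw [flip_eq_siteFlip (by omega) (by omega) (by omega) hc, ← hc]
  have hS : jwSign L (siteFlip 0 (siteFlip k η)) =
      jwSign k η * if η (k : ZMod L) then (-1 : ℝ) else 1 := by
    rw [jwSign_siteFlip_of_lt (by omega) le_rfl, jwSign_siteFlip_of_lt (by omega) le_rfl, neg_neg,
      ← jwSign_succ, hk]
  have hf' : jwSign k η * (if η (k : ZMod L) then (-1 : ℝ) else 1) * f (siteFlip 0 (siteFlip k η))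
      = f (siteFlip 0 (siteFlip k η)) := by
    rw [← hS]
    by_cases h : jwSign L (siteFlip 0 (siteFlip k η)) = 1
    · rw [h, one_mul]
    · rw [hf _ h, mul_zero]
  simp only [ladder_apply, occ]
  rw [siteFlip_of_ne (i := k) (j := 0) (by omega) (by omega) (by omega),
    siteFlip_of_ne (i := 0) (j := k) (by omega) (by omega) (by omega),
    jwSign_siteFlip_of_lt (k := k) (j := 0) (by omega) (by omega),
    jwSign_siteFlip_of_le (k := 0) (j := k) (by omega) (by omega),
    siteFlip_comm (i := k) (j := 0) (by omega) (by omega) (by omega),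
    show jwSign 0 η = 1 by simp [jwSign]]
  revert hf'
  cases h1 : η (k : ZMod L) <;> cases h2 : η ((0 : ℕ) : ZMod L) <;>
    simp only [Bool.false_eq_true, Bool.true_eq_false, if_true, if_false, mul_zero, mul_one,
      one_mul, mul_neg, neg_mul] <;>
    intro h
  · linear_combination -μ * h
  · linear_combination -(μ + w * z) * h
  · linear_combination -(μ + w * z) * h
  · linear_combination -(μ + 2 * w * z) * h

theorem flipTerm_eq_antiLadder {k : ℕ} (hL : 2 ≤ L) (hk : k < L) (w μ z : ℝ) {f : Config L → ℝ}
    (hf : ∀ η, jwSign L η ≠ 1 → f η = 0) (η : Config L) :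
    (μ + w * z * (occ η (k : ZMod L) + occ η ((k : ZMod L) + 1))) * f (flip (k : ZMod L) η) =
      μ * antiLadder (k + 1) false (ladder k false f) η
      + (μ + 2 * w * z) * ladder k true (antiLadder (k + 1) true f) η
      + (μ + w * z) * (ladder k true (antiLadder (k + 1) false f) η
        + antiLadder (k + 1) true (ladder k false f) η) := by
  unfold antiLadder
  split_ifs with h
  · rw [flipTerm_eq_ladder_last hL h w μ z hf]
    simp
    ring
  · exact flipTerm_eq_ladder_of_lt (by omega) w μ z f η

theorem sum_rate (w μ : ℝ) (η : Config L) : ∑ k ∈ Finset.range L, rate w μ η (k : ZMod L) =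
    μ * L + 2 * w * ∑ k ∈ Finset.range L, occ η (k : ZMod L) := by
  have h : ∑ k ∈ Finset.range L, occ η ((k : ZMod L) + 1) =
      ∑ k ∈ Finset.range L, occ η (k : ZMod L) := by
    have h1 := Finset.sum_range_succ (fun k : ℕ => occ η (k : ZMod L)) L
    have h2 := Finset.sum_range_succ' (fun k : ℕ => occ η (k : ZMod L)) L
    simp only [Nat.cast_add, Nat.cast_one, ZMod.natCast_self, Nat.cast_zero] at h1 h2
    linarith
  simp only [rate, Finset.sum_add_distrib, ← Finset.mul_sum, h]
  simp
  ring

theorem sum_antiDelta_smul {E : Type*} [AddCommGroup E] [Module ℝ E] {F : ℕ → E}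
    (hF : F L = -F 0) (hL : 0 < L) {k : ℕ} (hk : k ≤ L) :
    ∑ n ∈ Finset.range L, antiDelta L (n - k) • F n = F k := by
  have hlt : ∀ k < L, ∑ n ∈ Finset.range L, antiDelta L (n - k) • F n = F k := by
    intro k hk
    rw [Finset.sum_eq_single_of_mem k (Finset.mem_range.2 hk), sub_self, antiDelta_zero hL,
      one_smul]
    intro n hn hne
    rw [antiDelta_eq_zero (by rwa [dvd_sub_iff_eq (Finset.mem_range.1 hn) hk]), zero_smul]
  rcases hk.lt_or_eq with hk | rfl
  · exact hlt k hk
  · rw [hF, ← hlt 0 hL, ← Finset.sum_neg_distrib]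
    refine Finset.sum_congr rfl fun n _ => ?_
    have hanti := antiDelta_add hL (n - k)
    rw [sub_add_cancel] at hanti
    rw [Nat.cast_zero, sub_zero, hanti, neg_smul, neg_neg]

theorem antiLadder_creation (hL : 0 < L) {k : ℕ} (hk : k ≤ L) (f : Config L → ℝ) :
    antiLadder k true f = ∑ n ∈ Finset.range L, antiDelta L (n - k) • ladder n true f := by
  rw [← sum_antiDelta_smul (F := fun n => antiLadder n true f) _ hL hk]
  · refine Finset.sum_congr rfl fun n hn => ?_
    rw [antiLadder_of_lt (Finset.mem_range.1 hn)]
  · rw [antiLadder_self, antiLadder_of_lt hL, LinearMap.neg_apply]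

theorem antiLadder_annihilation_creation (hL : 0 < L) {k m : ℕ} (hk : k ≤ L) (hm : m < L)
    (f : Config L → ℝ) : antiLadder k false (ladder m true f) =
      antiDelta L (m - k) • f - ladder m true (antiLadder k false f) := by
  have hlt : ∀ k < L, ladder k false (ladder m true f) =
      antiDelta L (m - k) • f - ladder m true (ladder k false f) := by
    intro k hk
    rw [annihilation_creation hk hm]
    split_ifs with hkm
    · rw [hkm, sub_self, antiDelta_zero hL]
      module
    · rw [antiDelta_eq_zero (by rwa [dvd_sub_iff_eq hm hk, eq_comm])]
      module
  rcases hk.lt_or_eq with hk | rfl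
  · rw [antiLadder_of_lt hk, hlt k hk]
  · have hanti := antiDelta_add hL (m - k)
    rw [sub_add_cancel] at hanti
    rw [antiLadder_self, LinearMap.neg_apply, LinearMap.neg_apply, hlt 0 hL, Nat.cast_zero,
      sub_zero, hanti, map_neg]
    module

/-- The translation-invariant pair creation operator `∑ Q (n - m) C_m C_n` applied to `f`, as a
linear function of the amplitude `Q`. -/
def pairCreation (f : Config L → ℝ) : (ℤ → ℝ) →ₗ[ℝ] (Config L → ℝ) :=
  ∑ m ∈ Finset.range L, ∑ n ∈ Finset.range L,
    (LinearMap.proj ((n : ℤ) - m)).smulRight (ladder m true (ladder n true f))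

theorem pairCreation_apply (f : Config L → ℝ) (Q : ℤ → ℝ) : pairCreation f Q =
    ∑ m ∈ Finset.range L, ∑ n ∈ Finset.range L, Q (n - m) • ladder m true (ladder n true f) := by
  simp [pairCreation, LinearMap.sum_apply]

theorem pairCreation_eq_zero_of_even (f : Config L → ℝ) {Q : ℤ → ℝ} (hQ : ∀ x, Q (-x) = Q x) :
    pairCreation f Q = 0 := by
  rw [← self_eq_neg]
  conv_lhs => rw [pairCreation_apply, Finset.sum_comm]
  simp only [pairCreation_apply, ← Finset.sum_neg_distrib]
  refine Finset.sum_congr rfl fun m hm => Finset.sum_congr rfl fun n hn => ?_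
  rw [ladder_anticomm_same (Finset.mem_range.1 hn) (Finset.mem_range.1 hm), ← hQ, neg_sub, 
    smul_neg]

theorem sum_creation_creation (hL : 0 < L) (f : Config L → ℝ) :
    ∑ k ∈ Finset.range L, ladder k true (antiLadder (k + 1) true f) =
      pairCreation f fun x => antiDelta L (x - 1) := by
  rw [pairCreation_apply]
  refine Finset.sum_congr rfl fun k hk => ?_
  rw [antiLadder_creation hL (Finset.mem_range.1 hk), map_sum]
  simp only [map_smul, Nat.cast_succ, sub_add_eq_sub_sub]

section PairState

variable {g : ℤ → ℝ} {ψ : Config L → ℝ} (hψ : ∀ i < L, ladder i false ψ =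
  ∑ n ∈ Finset.range L, g (n - i) • ladder n true ψ)

include hψ

theorem sum_occupation :
    ∑ k ∈ Finset.range L, ladder k true (ladder k false ψ) = pairCreation ψ g := by
  rw [pairCreation_apply]
  refine Finset.sum_congr rfl fun k hk => ?_
  rw [hψ k (Finset.mem_range.1 hk), map_sum]
  simp only [map_smul]

variable (hg : ∀ x, g (x + L) = -g x)

include hg

theorem antiLadder_annihilation (hL : 0 < L) {k : ℕ} (hk : k ≤ L) :
    antiLadder k false ψ = ∑ n ∈ Finset.range L, g (n - k) • ladder n true ψ := by
  rcases hk.lt_or_eq with hk | rfl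
  · rw [antiLadder_of_lt hk, hψ k hk]
  · rw [antiLadder_self, LinearMap.neg_apply, hψ 0 hL, ← Finset.sum_neg_distrib]
    refine Finset.sum_congr rfl fun n _ => ?_
    have hanti := hg (n - k)
    rw [sub_add_cancel] at hanti
    rw [Nat.cast_zero, sub_zero, hanti, neg_smul, neg_neg]

theorem sum_hop_left (hL : 0 < L) :
    ∑ k ∈ Finset.range L, ladder k true (antiLadder (k + 1) false ψ) =
      pairCreation ψ fun x => g (x - 1) := by
  rw [pairCreation_apply]
  refine Finset.sum_congr rfl fun k hk => ?_
  rw [antiLadder_annihilation hψ hg hL (Finset.mem_range.1 hk), map_sum]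
  simp only [map_smul, Nat.cast_succ, sub_add_eq_sub_sub]

theorem antiLadder_annihilation_annihilation (hL : 0 < L) {k : ℕ} (hk : k < L) :
    antiLadder (k + 1) false (ladder k false ψ) = g 1 • ψ -
      ∑ m ∈ Finset.range L, ∑ n ∈ Finset.range L,
        (g (m - k) * g (n - (k + 1 : ℕ))) • ladder m true (ladder n true ψ) := by
  have hreproduce : ∑ m ∈ Finset.range L, antiDelta L (m - (k + 1 : ℕ)) • g (m - k) = g 1 := by
    rw [sum_antiDelta_smul (F := fun m : ℕ => g (m - k)) _ hL hk]
    · push_cast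
      rw [add_sub_cancel_left]
    · rw [← hg]
      congr 1
      push_cast
      ring
  rw [hψ k hk, map_sum, ← hreproduce, Finset.sum_smul, ← Finset.sum_sub_distrib]
  refine Finset.sum_congr rfl fun m hm => ?_
  rw [map_smul, antiLadder_annihilation_creation hL hk (Finset.mem_range.1 hm),
    antiLadder_annihilation hψ hg hL hk, map_sum, smul_sub, Finset.smul_sum]
  simp only [map_smul, smul_smul, smul_eq_mul, mul_comm]

theorem sum_annihilation_annihilation (hL : 0 < L) {Q : ℤ → ℝ}
    (hQ : ∀ m n : ℕ, ∑ k ∈ Finset.range L, g (m - k) * g (n - (k + 1 : ℕ)) = Q (n - m)) :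
    ∑ k ∈ Finset.range L, antiLadder (k + 1) false (ladder k false ψ) =
      (L * g 1) • ψ - pairCreation ψ Q := by
  have hterm := fun k hk =>
    antiLadder_annihilation_annihilation hψ hg hL (Finset.mem_range (m := k).1 hk)
  rw [Finset.sum_congr rfl hterm, Finset.sum_sub_distrib, Finset.sum_const, Finset.card_range,
    ← Nat.cast_smul_eq_nsmul ℝ, smul_smul, pairCreation_apply, Finset.sum_comm]
  congr 1
  refine Finset.sum_congr rfl fun m _ => ?_
  rw [Finset.sum_comm]
  simp only [← Finset.sum_smul, hQ]

theorem sum_hop_right (hL : 0 < L) :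
    ∑ k ∈ Finset.range L, antiLadder (k + 1) true (ladder k false ψ) =
      pairCreation ψ fun x => g (x + 1) := by
  set F : ℕ → Config L → ℝ := fun k => ∑ n ∈ Finset.range L,
    g (n - k + 1) • antiLadder k true (ladder n true ψ) with hF
  have hsucc : ∀ k ∈ Finset.range L, antiLadder (k + 1) true (ladder k false ψ) = F (k + 1) := by
    intro k hk
    rw [hψ k (Finset.mem_range.1 hk), map_sum]
    refine Finset.sum_congr rfl fun n _ => ?_
    rw [map_smul]
    congr 2
    push_cast
    ring
  have hperiod : F L = F 0 := by
    refine Finset.sum_congr rfl fun n _ => ?_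
    have hanti := hg (n - L + 1)
    rw [show (n : ℤ) - L + 1 + L = n - (0 : ℕ) + 1 by push_cast; ring] at hanti
    rw [antiLadder_self, antiLadder_of_lt hL, LinearMap.neg_apply, hanti, neg_smul, smul_neg]
  have hshift := Finset.sum_range_succ F L
  rw [Finset.sum_range_succ', hperiod] at hshift
  rw [Finset.sum_congr rfl hsucc, add_right_cancel hshift, pairCreation_apply]
  refine Finset.sum_congr rfl fun k hk => ?_
  rw [hF, ← antiLadder_of_lt (Finset.mem_range.1 hk)]

end PairState

theorem tiltedGen_eq_ladder (hL : 2 ≤ L) (w μ z : ℝ) {f : Config L → ℝ}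
    (hf : ∀ η, jwSign L η ≠ 1 → f η = 0) :
    tiltedGen w μ L z f =
      μ • ∑ k ∈ Finset.range L, antiLadder (k + 1) false (ladder k false f)
      + (μ + 2 * w * z) • ∑ k ∈ Finset.range L, ladder k true (antiLadder (k + 1) true f)
      + (μ + w * z) • (∑ k ∈ Finset.range L, ladder k true (antiLadder (k + 1) false f)
        + ∑ k ∈ Finset.range L, antiLadder (k + 1) true (ladder k false f))
      - ((μ * L) • f + (2 * w) • ∑ k ∈ Finset.range L, ladder k true (ladder k false f)) := by
  ext η
  have hterm := fun k hk =>
    flipTerm_eq_antiLadder hL (Finset.mem_range (m := k).1 hk) w μ z hf η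
  have hocc : ∀ k ∈ Finset.range L, ladder k true (ladder k false f) η = occ η k * f η :=
    fun k hk => creation_annihilation_self (Finset.mem_range.1 hk) f η
  simp only [tiltedGen, Finset.sum_sub_distrib, ← Finset.sum_mul, sum_rate,
    Finset.sum_congr rfl hterm, Pi.add_apply, Pi.sub_apply, Pi.smul_apply, Finset.sum_apply,
    smul_eq_mul, Finset.sum_congr rfl hocc, Finset.sum_add_distrib, ← Finset.mul_sum]
  ring

theorem tiltedGen_eq_topEigenvalue_smul {w μ z : ℝ} (hμ : 0 < μ) (hw : 0 < w) (hz : 0 ≤ z)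
    (hL : 2 ≤ L) {ψ : Config L → ℝ} (heven : ∀ η, jwSign L η ≠ 1 → ψ η = 0)
    (hψ : ∀ i < L, ladder i false ψ =
      ∑ n ∈ Finset.range L, pairAmplitude w μ L z (n - i) • ladder n true ψ) :
    tiltedGen w μ L z ψ = topEigenvalue w μ L z • ψ := by
  have hL0 : 0 < L := by omega
  have hg (x : ℤ) : pairAmplitude w μ L z (x + L) = -pairAmplitude w μ L z x := sineSum_add hL0 _ x
  have hres := pairCreation_eq_zero_of_even ψ (pairResidual_neg hμ hw hz L)
  rw [pairResidual, map_sub, map_add, map_add, map_smul, map_smul, map_smul, map_smul, map_add]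
    at hres
  rw [tiltedGen_eq_ladder hL w μ z heven,
    sum_annihilation_annihilation (Q := pairConvolution w μ L z) hψ hg hL0
      (sum_pairAmplitude_mul w μ z hL0),
    sum_creation_creation hL0, sum_hop_left hψ hg hL0,
    sum_hop_right hψ hg hL0, sum_occupation hψ,
    topEigenvalue_eq_pairAmplitude hμ hw hz hL, ← sub_eq_zero, ← hres]
  module

end Eigenvector

section Positivity

variable {L : ℕ}

/-- The pair state with amplitude `pairAmplitude`, which turns out to be the Perron eigenvector of
the tilted generator in the even sector. Each unordered pair of sites occurs twice in the list,
hence the factor `1 / 2`. -/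
def bcsState (w μ : ℝ) (L : ℕ) (z : ℝ) : Config L → ℝ :=
  pairState L (fun e => 1 / 2 * pairAmplitude w μ L z (e.2 - e.1))
    (Finset.range L ×ˢ Finset.range L).toList

theorem lt_of_mem_toList_range_product {e : ℕ × ℕ}
    (he : e ∈ (Finset.range L ×ˢ Finset.range L).toList) : e.1 < L ∧ e.2 < L := by
  simpa using he

theorem continuous_bcsState {w μ : ℝ} (hμ : 0 < μ) (hw : 0 < w) (η : Config L) :
    Continuous fun z : Set.Ioc (0 : ℝ) 1 => bcsState w μ L z η :=
  continuous_pairState (fun _ => continuous_const.mul (continuous_pairAmplitude hμ hw L _)) _ η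

theorem bcsState_emptyConfig (w μ z : ℝ) : bcsState w μ L z (emptyConfig L) = 1 :=
  pairState_emptyConfig _ _

theorem bcsState_eq_zero_of_jwSign_ne_one (w μ z : ℝ) {η : Config L} (hη : jwSign L η ≠ 1) :
    bcsState w μ L z η = 0 :=
  pairState_eq_zero_of_jwSign_ne_one _ (fun _ => lt_of_mem_toList_range_product) hη

theorem annihilation_bcsState (w μ z : ℝ) {i : ℕ} (hi : i < L) :
    ladder i false (bcsState w μ L z) =
      ∑ n ∈ Finset.range L, pairAmplitude w μ L z (n - i) • ladder n true (bcsState w μ L z) := by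
  have hcontraction (m n : ℕ) :
      (1 / 2 * pairAmplitude w μ L z (n - m)) • contraction i (m, n) (bcsState w μ L z) =
      (if i = m then (1 / 2 * pairAmplitude w μ L z (n - m)) • ladder n true (bcsState w μ L z)
        else 0) +
      (if i = n then (1 / 2 * pairAmplitude w μ L z (m - n)) • ladder m true (bcsState w μ L z)
        else 0) := by
    have hneg : pairAmplitude w μ L z (n - m) = -pairAmplitude w μ L z (m - n) := by
      rw [pairAmplitude, pairAmplitude, ← sineSum_neg, neg_sub]
    unfold contraction
    split_ifs <;> simp [hneg, smul_sub]
  rw [bcsState, annihilation_pairState _ (fun _ => lt_of_mem_toList_range_product) hi, ← bcsState,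
    Finset.sum_map_toList, LinearMap.sum_apply, Finset.sum_product]
  simp only [LinearMap.smul_apply, hcontraction, Finset.sum_add_distrib]
  rw [Finset.sum_comm]
  simp only [Finset.sum_ite_eq, if_pos (Finset.mem_range.2 hi)]
  rw [← Finset.sum_add_distrib]
  refine Finset.sum_congr rfl fun n _ => ?_
  module

theorem tiltedGen_bcsState {w μ z : ℝ} (hμ : 0 < μ) (hw : 0 < w) (hz : 0 ≤ z) (hL : 2 ≤ L) :
    tiltedGen w μ L z (bcsState w μ L z) = topEigenvalue w μ L z • bcsState w μ L z :=
  tiltedGen_eq_topEigenvalue_smul hμ hw hz hL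
    (fun _ => bcsState_eq_zero_of_jwSign_ne_one w μ z) fun _ => annihilation_bcsState w μ z

theorem exists_flip_eq_siteFlip (hL : 2 ≤ L) {k : ℕ} (hk : k < L) (η : Config L) :
    ∃ l < L, l ≠ k ∧ flip (k : ZMod L) η = siteFlip l (siteFlip k η) := by
  rcases eq_or_ne (k + 1) L with h | h
  · refine ⟨0, by omega, by omega, flip_eq_siteFlip hk (by omega) (by omega) ?_ η⟩
    rw [← Nat.cast_add_one, h, ZMod.natCast_self, Nat.cast_zero]
  · exact ⟨k + 1, by omega, by omega, flip_eq_siteFlip hk (by omega) (by omega) (by simp) η⟩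

theorem jwSign_flip (hL : 2 ≤ L) {k : ℕ} (hk : k < L) (η : Config L) :
    jwSign L (flip (k : ZMod L) η) = jwSign L η := by
  obtain ⟨l, hl, -, h⟩ := exists_flip_eq_siteFlip hL hk η
  rw [h, jwSign_siteFlip_of_lt hl le_rfl, jwSign_siteFlip_of_lt hk le_rfl, neg_neg]

theorem flip_flip (k : ZMod L) (η : Config L) : flip k (flip k η) = η := by
  funext j
  simp only [flip]
  split_ifs <;> simp

theorem eq_emptyConfig_of_vacant (hL : 0 < L) {η : Config L} (hη : jwSign L η = 1)
    (hvacant : ∀ i : ℕ, 0 < i → i < L → η (i : ZMod L) = false) : η = emptyConfig L := by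
  have : NeZero L := ⟨hL.ne'⟩
  have hzero : η ((0 : ℕ) : ZMod L) = false := by
    rw [jwSign, Finset.prod_eq_single_of_mem 0 (Finset.mem_range.2 hL)] at hη
    · cases hocc : η ((0 : ℕ) : ZMod L)
      · rfl
      · rw [hocc] at hη
        norm_num at hη
    · intro i hi hne
      simp [hvacant i (by omega) (Finset.mem_range.1 hi)]
  funext j
  rw [← ZMod.natCast_zmod_val j]
  rcases Nat.eq_zero_or_pos j.val with hj | hj
  · rw [hj, hzero, emptyConfig]
  · rw [hvacant _ hj (ZMod.val_lt j), emptyConfig]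

section FlipClosed

variable {P : Config L → Prop} (hP : ∀ η, ∀ k < L, P η → P (flip (k : ZMod L) η))

include hP

theorem siteFlip_siteFlip_zero_of_flip_closed {j : ℕ} (hj : j + 1 < L) {η : Config L} (h : P η) :
    P (siteFlip (j + 1) (siteFlip 0 η)) := by
  induction j with
  | zero =>
    rw [← flip_eq_siteFlip (by omega) hj (by omega) (by simp)]
    exact hP _ _ (by omega) h
  | succ j ih =>
    have hflip := hP _ (j + 1) (by omega) (ih (by omega))
    rw [flip_eq_siteFlip (by omega) hj (by omega) (by push_cast; rfl), siteFlip_siteFlip] at hflip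
    exact hflip

theorem exists_vacant_of_flip_closed {η : Config L} (hη : jwSign L η = 1) (h : P η) {n : ℕ}
    (hn : n < L) : ∃ η', P η' ∧ jwSign L η' = 1 ∧
      ∀ i : ℕ, 0 < i → i ≤ n → η' (i : ZMod L) = false := by
  induction n with
  | zero => exact ⟨η, h, hη, fun i _ _ => by omega⟩
  | succ n ih =>
    obtain ⟨η', hPη', hsign, hvacant⟩ := ih (by omega)
    cases hocc : η' ((n + 1 : ℕ) : ZMod L)
    · refine ⟨η', hPη', hsign, fun i hi0 hi => ?_⟩
      rcases Nat.le_succ_iff.1 hi with hi | rfl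
      · exact hvacant i hi0 hi
      · exact hocc
    · refine ⟨_, siteFlip_siteFlip_zero_of_flip_closed hP hn hPη', ?_, fun i hi0 hi => ?_⟩
      · rw [jwSign_siteFlip_of_lt hn le_rfl, jwSign_siteFlip_of_lt (by omega) le_rfl, neg_neg,
          hsign]
      · rcases Nat.le_succ_iff.1 hi with hi | rfl
        · rw [siteFlip_of_ne (by omega) hn (by omega),
            siteFlip_of_ne (by omega) (by omega) (by omega), hvacant i hi0 hi]
        · rw [siteFlip_self, siteFlip_of_ne hn (by omega) (by omega), hocc, Bool.not_true]

theorem emptyConfig_of_flip_closed (hL : 0 < L) {η : Config L} (hη : jwSign L η = 1)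
    (h : P η) : P (emptyConfig L) := by
  obtain ⟨η', hPη', hsign, hvacant⟩ :=
    exists_vacant_of_flip_closed hP hη h (show L - 1 < L by omega)
  rwa [← eq_emptyConfig_of_vacant hL hsign fun i hi0 hi => hvacant i hi0 (by omega)]

theorem forall_even_of_flip_closed (hL : 0 < L) {η₀ η : Config L} (h₀ : jwSign L η₀ = 1)
    (h : P η₀) (hη : jwSign L η = 1) : P η := by
  by_contra hn
  refine emptyConfig_of_flip_closed (P := fun η => ¬P η) (fun η k hk hPη hflip => hPη ?_) hL hη hn
    (emptyConfig_of_flip_closed hP hL h₀ h)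
  rw [← flip_flip (k : ZMod L) η]
  exact hP _ k hk hflip

end FlipClosed

theorem occ_nonneg (η : Config L) (k : ZMod L) : 0 ≤ occ η k := by
  unfold occ; split_ifs <;> norm_num

theorem eq_zero_of_nonneg_eigenvector {w μ z c : ℝ} (hμ : 0 < μ) (hw : 0 < w) (hz : 0 ≤ z)
    (hL : 2 ≤ L) {f : Config L → ℝ} (hf : ∀ η, jwSign L η = 1 → 0 ≤ f η)
    (heig : ∀ η, jwSign L η = 1 → tiltedGen w μ L z f η = c * f η) {η₀ η : Config L}
    (h₀ : jwSign L η₀ = 1) (h : f η₀ = 0) (hη : jwSign L η = 1) : f η = 0 := by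
  refine (forall_even_of_flip_closed (P := fun η => jwSign L η = 1 ∧ f η = 0) ?_ (by omega) h₀
    ⟨h₀, h⟩ hη).2
  rintro η k hk ⟨hsign, hzero⟩
  refine ⟨by rw [jwSign_flip hL hk, hsign], ?_⟩
  have hsum := heig η hsign
  rw [hzero, mul_zero, tiltedGen] at hsum
  have hrate : ∀ i : ℕ, 0 < μ + w * z * (occ η (i : ZMod L) + occ η ((i : ZMod L) + 1)) := by
    intro i
    have := occ_nonneg η (i : ZMod L)
    have := occ_nonneg η ((i : ZMod L) + 1)
    positivity
  rw [Finset.sum_eq_zero_iff_of_nonneg] at hsum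
  · have hterm := hsum k (Finset.mem_range.2 hk)
    rw [hzero, mul_zero, sub_zero] at hterm
    exact (mul_eq_zero.1 hterm).resolve_left (hrate k).ne'
  · intro i hi
    rw [hzero, mul_zero, sub_zero]
    exact mul_nonneg (hrate i).le (hf _ (by rw [jwSign_flip hL (Finset.mem_range.1 hi), hsign]))

theorem tiltedGen_one_sub_const (w μ : ℝ) (f : Config L → ℝ) (a : ℝ) (η : Config L) :
    tiltedGen w μ L 1 (fun η => f η - a) η = tiltedGen w μ L 1 f η := by
  refine Finset.sum_congr rfl fun k _ => ?_
  rw [rate]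
  ring

theorem topEigenvalue_one {w μ : ℝ} (hμ : 0 < μ) (hw : 0 < w) (hL : 2 ≤ L) :
    topEigenvalue w μ L 1 = 0 := by
  have hsqrt : ∀ q, Real.sqrt (dispersion w μ 1 q) = μ + w - w * Real.cos q := by
    intro q
    rw [← Real.sqrt_sq (show 0 ≤ μ + w - w * Real.cos q by nlinarith [Real.cos_le_one q])]
    congr 1
    rw [dispersion, Real.sin_sq]
    ring
  simp only [topEigenvalue, hsqrt, Finset.sum_sub_distrib, ← Finset.mul_sum, sum_cos_momentum hL]
  simp
  ring

theorem bcsState_one {w μ : ℝ} (hμ : 0 < μ) (hw : 0 < w) (hL : 2 ≤ L) {η : Config L}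
    (hη : jwSign L η = 1) : bcsState w μ L 1 η = 1 := by
  have : NeZero L := ⟨by omega⟩
  set f := bcsState w μ L 1
  obtain ⟨η₀, hη₀, hmin⟩ := Set.exists_min_image {η : Config L | jwSign L η = 1} f
    (Set.toFinite _) ⟨_, jwSign_emptyConfig L⟩
  have hconst : ∀ η, jwSign L η = 1 → f η - f η₀ = 0 := by
    intro η hη
    refine eq_zero_of_nonneg_eigenvector (c := 0) (f := fun η => f η - f η₀) hμ hw zero_le_one hL
      (fun η hη => sub_nonneg.2 (hmin η hη)) (fun η _ => ?_) hη₀ (sub_self _) hη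
    rw [tiltedGen_one_sub_const, tiltedGen_bcsState hμ hw zero_le_one hL,
      topEigenvalue_one hμ hw hL, zero_smul, zero_mul, Pi.zero_apply]
  have hempty := hconst _ (jwSign_emptyConfig L)
  rw [show f (emptyConfig L) = 1 from bcsState_emptyConfig w μ 1] at hempty
  linarith [hconst η hη]

theorem bcsState_pos {w μ : ℝ} (hμ : 0 < μ) (hw : 0 < w) (hL : 2 ≤ L) {z : ℝ}
    (hz : z ∈ Set.Ioc 0 1) {η : Config L} (hη : jwSign L η = 1) : 0 < bcsState w μ L z η := by
  have : NeZero L := ⟨by omega⟩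
  set S : Set (Set.Ioc (0 : ℝ) 1) := {z | ∀ η, jwSign L η = 1 → 0 < bcsState w μ L z η} with hS
  -- A nonnegative eigenvector that vanishes somewhere on the even sector vanishes at the empty
  -- configuration, so the strict inequality is also a closed condition on the fugacity.
  have hS_nonneg : S = {z : Set.Ioc (0 : ℝ) 1 | ∀ η, jwSign L η = 1 → 0 ≤ bcsState w μ L z η} := by
    ext z
    refine ⟨fun h η hη => (h η hη).le, fun h η hη => (h η hη).lt_of_ne fun hzero => ?_⟩
    have hempty := eq_zero_of_nonneg_eigenvector hμ hw z.2.1.le hL h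
      (fun η _ => congrFun (tiltedGen_bcsState hμ hw z.2.1.le hL) η) hη hzero.symm
      (jwSign_emptyConfig L)
    rw [bcsState_emptyConfig] at hempty
    exact one_ne_zero hempty
  have hopen : IsOpen S := by
    simp only [hS, Set.ofPred_forall]
    exact isOpen_iInter_of_finite fun η => isOpen_iInter_of_finite fun _ =>
      isOpen_lt continuous_const (continuous_bcsState hμ hw η)
  have hclosed : IsClosed S := by
    simp only [hS_nonneg, Set.ofPred_forall]
    exact isClosed_iInter fun η => isClosed_iInter fun _ =>
      isClosed_le continuous_const (continuous_bcsState hμ hw η)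
  have hone : (⟨1, by simp⟩ : Set.Ioc (0 : ℝ) 1) ∈ S := fun η hη => by
    simp [bcsState_one hμ hw hL hη]
  have : PreconnectedSpace (Set.Ioc (0 : ℝ) 1) := Subtype.preconnectedSpace isPreconnected_Ioc
  have huniv := IsClopen.eq_univ ⟨hclosed, hopen⟩ ⟨_, hone⟩
  exact (huniv ▸ Set.mem_univ _ : (⟨z, hz⟩ : Set.Ioc (0 : ℝ) 1) ∈ S) η hη

theorem jwSign_eq_one_iff (hL : 0 < L) (η : Config L) :
    jwSign L η = 1 ↔ Even (particleNumber η) := by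
  have : NeZero L := ⟨hL.ne'⟩
  have h : {k | η k = true} =
      (((Finset.range L).filter fun i : ℕ => η (i : ZMod L) = true).image
        (fun i : ℕ => (i : ZMod L)) : Finset (ZMod L)) := by
    ext k
    simp only [Set.mem_ofPred_eq, Finset.coe_image, Finset.coe_filter, Finset.mem_range,
      Set.mem_image]
    refine ⟨fun hk => ⟨k.val, ⟨ZMod.val_lt k, ?_⟩, ZMod.natCast_zmod_val k⟩, ?_⟩
    · rwa [ZMod.natCast_zmod_val]
    · rintro ⟨i, ⟨-, hi⟩, rfl⟩
      exact hi
  rw [particleNumber, h, Set.ncard_coe_finset, Finset.card_image_of_injOn, jwSign,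
    Finset.prod_ite, Finset.prod_const, Finset.prod_const_one, mul_one]
  · exact neg_one_pow_eq_one_iff_even (by norm_num)
  · intro i hi j hj hij
    simp only [Finset.coe_filter, Finset.mem_range, Set.mem_ofPred_eq] at hi hj
    exact (natCast_inj_of_lt hi.1 hj.1).1 hij

end Positivity

section Semigroup

variable {E : Type*} [NormedAddCommGroup E] [NormedSpace ℝ E] [CompleteSpace E]

theorem hasSum_exp_apply (T : E →L[ℝ] E) (f : E) :
    HasSum (fun n : ℕ => ((n.factorial : ℝ)⁻¹) • (T ^ n) f) (NormedSpace.exp T f) := by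
  have h := NormedSpace.exp_series_hasSum_exp' (𝕂 := ℝ) T
  simpa using h.mapL (ContinuousLinearMap.apply ℝ E f)

theorem exp_apply_of_apply_eq_smul {T : E →L[ℝ] E} {f : E} {c : ℝ} (h : T f = c • f) :
    NormedSpace.exp T f = Real.exp c • f := by
  have hpow : ∀ n : ℕ, (T ^ n) f = c ^ n • f := by
    intro n
    induction n with
    | zero => simp
    | succ n ih => rw [pow_succ', mul_apply_eq_comp, ih, map_smul, h, smul_smul, pow_succ]
  have hsum := (NormedSpace.exp_series_hasSum_exp' (𝕂 := ℝ) c).smul_const f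
  rw [← Real.exp_eq_exp_ℝ] at hsum
  refine (hasSum_exp_apply T f).unique ?_
  simpa only [hpow, smul_smul, smul_eq_mul] using hsum

/-- `exp T = exp (-c) • exp (T + c)`, and every term of the exponential series of `T + c` preserves
the cone. -/
theorem exp_apply_mem_of_add_smul_mem {T : E →L[ℝ] E} {P : Set E} (hP : IsClosed P)
    (h0 : (0 : E) ∈ P) (hadd : ∀ f ∈ P, ∀ g ∈ P, f + g ∈ P)
    (hsmul : ∀ a : ℝ, 0 ≤ a → ∀ f ∈ P, a • f ∈ P) (c : ℝ)
    (hT : ∀ f ∈ P, T f + c • f ∈ P) {f : E} (hf : f ∈ P) : NormedSpace.exp T f ∈ P := by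
  set S : E →L[ℝ] E := T + c • 1 with hS
  have hpow : ∀ n : ℕ, (S ^ n) f ∈ P := by
    intro n
    induction n with
    | zero => simpa using hf
    | succ n ih =>
      rw [pow_succ', mul_apply_eq_comp]
      simpa [hS] using hT _ ih
  have hexp : NormedSpace.exp S f ∈ P := by
    refine hP.mem_of_tendsto (hasSum_exp_apply S f) (Eventually.of_forall fun s => ?_)
    induction s using Finset.cons_induction with
    | empty => simpa using h0
    | cons n s hn ih =>
      rw [Finset.sum_cons]
      exact hadd _ (hsmul _ (by positivity) _ (hpow n)) _ ih
  let _ : NormedAlgebra ℚ (E →L[ℝ] E) := NormedAlgebra.restrictScalars ℚ ℝ _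
  have hcomm : Commute S ((-c) • (1 : E →L[ℝ] E)) := (Commute.one_right S).smul_right (-c)
  rw [show T = S + (-c) • 1 by rw [hS]; simp, NormedSpace.exp_add_of_commute hcomm,
    mul_apply_eq_comp, exp_apply_of_apply_eq_smul (c := -c) (f := f) (by simp), map_smul]
  exact hsmul _ (Real.exp_pos _).le _ hexp

end Semigroup

section MomentGen

variable {L : ℕ} {w μ s t : ℝ}

theorem jointGen_apply (w μ : ℝ) (f : BddFun L) (x : JointState L) :
    jointGen w μ L f x = jointGenFun w μ L f x := rfl

theorem continuous_bddFun_apply (x : JointState L) : Continuous fun f : BddFun L => f x :=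
  (lp.evalCLM ℝ (fun _ : JointState L => ℝ) ∞ x).continuous

theorem rate_le (hw : 0 ≤ w) (η : Config L) (k : ZMod L) : rate w μ η k ≤ μ + 2 * w := by
  have h₀ := (abs_le.1 (abs_occ_le_one η k)).2
  have h₁ := (abs_le.1 (abs_occ_le_one η (k + 1))).2
  unfold rate
  nlinarith

theorem jointGen_add_mul_nonneg (hμ : 0 ≤ μ) (hw : 0 ≤ w) (hL : 2 ≤ L) {f : BddFun L}
    (hf : ∀ η a, jwSign L η = 1 → 0 ≤ f (η, a)) {η : Config L} (hη : jwSign L η = 1) (a : ℕ) :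
    0 ≤ jointGen w μ L f (η, a) + L * (μ + 2 * w) * f (η, a) := by
  have hdiag : L * (μ + 2 * w) * f (η, a) = ∑ k ∈ Finset.range L, (μ + 2 * w) * f (η, a) := by
    rw [Finset.sum_const, Finset.card_range, nsmul_eq_mul, mul_assoc]
  rw [hdiag, jointGen_apply, jointGenFun, ← Finset.sum_add_distrib]
  refine Finset.sum_nonneg fun k hk => ?_
  have hflip : jwSign L (flip (k : ZMod L) η) = 1 := by
    rw [jwSign_flip hL (Finset.mem_range.1 hk), hη]
  have hocc := add_nonneg (occ_nonneg η (k : ZMod L)) (occ_nonneg η ((k : ZMod L) + 1))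
  have hescape := mul_le_mul_of_nonneg_right (rate_le (μ := μ) hw η (k : ZMod L)) (hf _ a hη)
  have hsilent := mul_nonneg hμ (hf _ a hflip)
  have hactive := mul_nonneg (mul_nonneg hw hocc) (hf _ (a + 1) hflip)
  linarith

theorem semigroup_nonneg (hμ : 0 ≤ μ) (hw : 0 ≤ w) (hL : 2 ≤ L) (ht : 0 ≤ t) {f : BddFun L}
    (hf : ∀ η a, jwSign L η = 1 → 0 ≤ f (η, a)) {η : Config L} (hη : jwSign L η = 1) (a : ℕ) :
    0 ≤ semigroup w μ L t f (η, a) := by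
  set P : Set (BddFun L) := {f | ∀ η a, jwSign L η = 1 → 0 ≤ f (η, a)} with hP
  suffices h : semigroup w μ L t f ∈ P from h η a hη
  have hclosed : IsClosed P := by
    simp only [hP, Set.ofPred_forall]
    exact isClosed_iInter fun η => isClosed_iInter fun a => isClosed_iInter fun _ =>
      isClosed_le continuous_const (continuous_bddFun_apply _)
  refine exp_apply_mem_of_add_smul_mem hclosed (fun η a _ => le_rfl) (fun f hf g hg η a h => ?_)
    (fun b hb f hf η a h => ?_) (t * (L * (μ + 2 * w))) (fun f hf η a h => ?_) hf
  · rw [lp.coeFn_add]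
    exact add_nonneg (hf η a h) (hg η a h)
  · rw [lp.coeFn_smul]
    exact mul_nonneg hb (hf η a h)
  · rw [smul_apply, mul_smul, ← smul_add, lp.coeFn_smul, lp.coeFn_add, lp.coeFn_smul]
    exact mul_nonneg ht (jointGen_add_mul_nonneg hμ hw hL hf h a)

theorem semigroup_mono (hμ : 0 ≤ μ) (hw : 0 ≤ w) (hL : 2 ≤ L) (ht : 0 ≤ t) {f g : BddFun L}
    (hfg : ∀ η a, jwSign L η = 1 → f (η, a) ≤ g (η, a)) {η : Config L} (hη : jwSign L η = 1)
    (a : ℕ) : semigroup w μ L t f (η, a) ≤ semigroup w μ L t g (η, a) := by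
  have h := semigroup_nonneg hμ hw hL ht (f := g - f)
    (fun η a hη => by simpa using hfg η a hη) hη a
  simpa using h

/-- The observable `(η, a) ↦ exp (s a) ψ η`, on which the generator of the joint process acts as
the tilted generator at fugacity `exp s`. -/
def expWeight [NeZero L] (hs : s ≤ 0) (ψ : Config L → ℝ) : BddFun L :=
  ⟨fun x => Real.exp (s * x.2) * ψ x.1, memℓp_infty ⟨∑ η, |ψ η|, by
    rintro _ ⟨x, rfl⟩
    have hexp : Real.exp (s * x.2) ≤ 1 := Real.exp_le_one_iff.2
      (mul_nonpos_of_nonpos_of_nonneg hs (by positivity))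
    have hψ : |ψ x.1| ≤ ∑ η, |ψ η| :=
      Finset.single_le_sum (f := fun η => |ψ η|) (fun _ _ => abs_nonneg _) (Finset.mem_univ x.1)
    dsimp only
    rw [norm_mul, Real.norm_of_nonneg (Real.exp_pos _).le, Real.norm_eq_abs]
    exact (mul_le_of_le_one_left (abs_nonneg _) hexp).trans hψ⟩⟩

theorem expWeight_apply [NeZero L] (hs : s ≤ 0) (ψ : Config L → ℝ) (x : JointState L) :
    expWeight hs ψ x = Real.exp (s * x.2) * ψ x.1 := rfl

theorem jointGen_expWeight [NeZero L] (hs : s ≤ 0) {ψ : Config L → ℝ} {c : ℝ}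
    (hψ : tiltedGen w μ L (Real.exp s) ψ = c • ψ) :
    jointGen w μ L (expWeight hs ψ) = c • expWeight hs ψ := by
  ext x
  have hx := congrFun hψ x.1
  rw [Pi.smul_apply, smul_eq_mul] at hx
  rw [lp.coeFn_smul, Pi.smul_apply, jointGen_apply, smul_eq_mul, expWeight_apply, mul_left_comm,
    ← hx, jointGenFun, tiltedGen, Finset.mul_sum]
  refine Finset.sum_congr rfl fun k _ => ?_
  simp only [expWeight_apply]
  rw [show s * ((x.2 + 1 : ℕ) : ℝ) = s * x.2 + s by push_cast; ring, Real.exp_add]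
  ring

theorem semigroup_expWeight [NeZero L] (hs : s ≤ 0) {ψ : Config L → ℝ} {c : ℝ}
    (hψ : tiltedGen w μ L (Real.exp s) ψ = c • ψ) (t : ℝ) (η : Config L) :
    semigroup w μ L t (expWeight hs ψ) (η, 0) = Real.exp (t * c) * ψ η := by
  rw [semigroup, exp_apply_of_apply_eq_smul (c := t * c)
    (by rw [smul_apply, jointGen_expWeight hs hψ, smul_smul]), lp.coeFn_smul, Pi.smul_apply,
    smul_eq_mul, expWeight_apply]
  simp

theorem hasSum_exp_smul_activityIndicator [NeZero L] (hs : s < 0) :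
    HasSum (fun a : ℕ => Real.exp (s * a) • activityIndicator L a)
      (expWeight hs.le fun _ => 1) := by
  have hnorm : ∀ a : ℕ, ‖Real.exp (s * a) • activityIndicator L a‖ ≤ Real.exp s ^ a := by
    intro a
    rw [norm_smul, Real.norm_of_nonneg (Real.exp_pos _).le, ← Real.exp_nat_mul, mul_comm s]
    refine mul_le_of_le_one_right (Real.exp_pos _).le (lp.norm_le_of_forall_le zero_le_one ?_)
    intro x
    change ‖if x.2 = a then (1 : ℝ) else 0‖ ≤ 1
    split_ifs <;> simp
  have hsummable : Summable fun a : ℕ => Real.exp (s * a) • activityIndicator L a :=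
    Summable.of_norm_bounded
      (summable_geometric_of_lt_one (Real.exp_pos _).le (Real.exp_lt_one_iff.2 hs)) hnorm
  convert hsummable.hasSum using 1
  ext x
  have heval := hsummable.hasSum.mapL (lp.evalCLM ℝ (fun _ : JointState L => ℝ) ∞ x)
  refine HasSum.unique ?_ heval
  rw [expWeight_apply, mul_one]
  refine (hasSum_ite_eq x.2 (Real.exp (s * x.2))).congr_fun fun a => ?_
  rw [map_smul]
  change Real.exp (s * a) * (if x.2 = a then (1 : ℝ) else 0) = _
  rcases eq_or_ne a x.2 with rfl | h
  · simp
  · simp [h, h.symm]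

theorem momentGen_eq_semigroup [NeZero L] (w μ : ℝ) (hs : s < 0) (η : Config L) (t : ℝ) :
    momentGen w μ L η s t = semigroup w μ L t (expWeight hs.le fun _ => 1) (η, 0) := by
  have h := (hasSum_exp_smul_activityIndicator hs).mapL
    ((lp.evalCLM ℝ (fun _ : JointState L => ℝ) ∞ (η, 0)).comp (semigroup w μ L t))
  refine (tsum_congr fun a => ?_).trans h.tsum_eq
  rw [map_smul]
  rfl

theorem mul_momentGen_le (hμ : 0 ≤ μ) (hw : 0 ≤ w) (hL : 2 ≤ L) (hs : s < 0) (ht : 0 ≤ t)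
    {ψ : Config L → ℝ} {b c : ℝ} (hψ : tiltedGen w μ L (Real.exp s) ψ = c • ψ)
    (hb : ∀ η, jwSign L η = 1 → b ≤ ψ η) {η : Config L} (hη : jwSign L η = 1) :
    b * momentGen w μ L η s t ≤ Real.exp (t * c) * ψ η := by
  have : NeZero L := ⟨by omega⟩
  rw [momentGen_eq_semigroup w μ hs, ← semigroup_expWeight hs.le hψ]
  refine le_of_eq_of_le ?_ (semigroup_mono hμ hw hL ht (f := b • expWeight hs.le fun _ => 1)
    (fun η a hη => ?_) hη 0)
  · rw [map_smul, lp.coeFn_smul, Pi.smul_apply, smul_eq_mul]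
  · rw [lp.coeFn_smul, Pi.smul_apply, smul_eq_mul, expWeight_apply, expWeight_apply, mul_one,
      mul_comm]
    exact mul_le_mul_of_nonneg_left (hb η hη) (Real.exp_pos _).le

theorem le_mul_momentGen (hμ : 0 ≤ μ) (hw : 0 ≤ w) (hL : 2 ≤ L) (hs : s < 0) (ht : 0 ≤ t)
    {ψ : Config L → ℝ} {b c : ℝ} (hψ : tiltedGen w μ L (Real.exp s) ψ = c • ψ)
    (hb : ∀ η, jwSign L η = 1 → ψ η ≤ b) {η : Config L} (hη : jwSign L η = 1) :
    Real.exp (t * c) * ψ η ≤ b * momentGen w μ L η s t := by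
  have hneg : tiltedGen w μ L (Real.exp s) (-ψ) = c • -ψ := by
    rw [smul_neg, ← hψ]
    funext η
    simp only [tiltedGen, Pi.neg_apply, ← Finset.sum_neg_distrib]
    exact Finset.sum_congr rfl fun k _ => by ring
  have h := mul_momentGen_le hμ hw hL hs ht hneg (b := -b)
    (fun η hη => neg_le_neg (hb η hη)) hη
  rw [Pi.neg_apply] at h
  linarith

theorem tendsto_log_div_of_exp_bounds {M : ℝ → ℝ} {a b c l : ℝ} (ha : 0 < a)
    (hlower : ∀ t, 0 ≤ t → a * Real.exp (t * c) ≤ M t)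
    (hupper : ∀ t, 0 ≤ t → M t ≤ b * Real.exp (t * c)) :
    Tendsto (fun t => Real.log (M t) / (l * t)) atTop (𝓝 (c / l)) := by
  have hb : 0 < b := by
    have := (hlower 0 le_rfl).trans (hupper 0 le_rfl)
    simp only [zero_mul, Real.exp_zero, mul_one] at this
    linarith
  have hlog : ∀ {d : ℝ}, 0 < d → ∀ {t : ℝ}, 0 < t →
      Real.log (d * Real.exp (t * c)) = (Real.log d / t + c) * t := by
    intro d hd t ht
    rw [Real.log_mul hd.ne' (Real.exp_pos _).ne', Real.log_exp]
    field_simp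
  have hlim : ∀ d : ℝ, Tendsto (fun t : ℝ => d / t + c) atTop (𝓝 c) := fun d => by
    simpa using (tendsto_const_nhds.div_atTop tendsto_id).add_const c
  have hquot : Tendsto (fun t => Real.log (M t) / t) atTop (𝓝 c) := by
    refine tendsto_of_tendsto_of_tendsto_of_le_of_le' (hlim (Real.log a)) (hlim (Real.log b)) ?_ ?_
    · filter_upwards [eventually_gt_atTop 0] with t ht
      rw [le_div_iff₀ ht, ← hlog ha ht]
      exact Real.log_le_log (by positivity) (hlower t ht.le)
    · filter_upwards [eventually_gt_atTop 0] with t ht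
      rw [div_le_iff₀ ht, ← hlog hb ht]
      exact Real.log_le_log (lt_of_lt_of_le (by positivity) (hlower t ht.le)) (hupper t ht.le)
  refine (hquot.div_const l).congr fun t => ?_
  rw [div_div, mul_comm]

theorem tendsto_scaledCGF (hμ : 0 < μ) (hw : 0 < w) (hL : 2 ≤ L) (hs : s < 0)
    {η : Config L} (hη : jwSign L η = 1) :
    Tendsto (fun t => scaledCGF w μ L η s t) atTop
      (𝓝 (topEigenvalue w μ L (Real.exp s) / L)) := by
  have : NeZero L := ⟨by omega⟩
  set ψ := bcsState w μ L (Real.exp s)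
  have hψ : tiltedGen w μ L (Real.exp s) ψ = topEigenvalue w μ L (Real.exp s) • ψ :=
    tiltedGen_bcsState hμ hw (Real.exp_pos s).le hL
  have hpos : ∀ η, jwSign L η = 1 → 0 < ψ η := fun η =>
    bcsState_pos hμ hw hL ⟨Real.exp_pos s, (Real.exp_lt_one_iff.2 hs).le⟩
  obtain ⟨η₁, hη₁, hmin⟩ := Set.exists_min_image {η : Config L | jwSign L η = 1} ψ
    (Set.toFinite _) ⟨η, hη⟩
  obtain ⟨η₂, hη₂, hmax⟩ := Set.exists_max_image {η : Config L | jwSign L η = 1} ψ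
    (Set.toFinite _) ⟨η, hη⟩
  refine tendsto_log_div_of_exp_bounds (a := ψ η / ψ η₂) (b := ψ η / ψ η₁)
    (div_pos (hpos η hη) (hpos η₂ hη₂)) (fun t ht => ?_) (fun t ht => ?_)
  · rw [div_mul_eq_mul_div, div_le_iff₀ (hpos η₂ hη₂)]
    linarith [le_mul_momentGen hμ.le hw.le hL hs ht hψ hmax hη]
  · rw [div_mul_eq_mul_div, le_div_iff₀ (hpos η₁ hη₁)]
    linarith [mul_momentGen_le hμ.le hw.le hL hs ht hψ hmin hη]

theorem limitCGF_eq (hμ : 0 < μ) (hw : 0 < w) (hL : 2 ≤ L) (hs : s < 0) :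
    limitCGF w μ L s = topEigenvalue w μ L (Real.exp s) / L :=
  (tendsto_scaledCGF hμ hw hL hs (jwSign_emptyConfig L)).limUnder_eq

end MomentGen

section Cumulants

theorem iteratedDeriv_energy {ν σ : ℝ} (h0 : 0 < ν) (h1 : ν < 1) (hσ : 0 < σ) (n : ℕ) :
    iteratedDeriv (n + 1) (energy ν σ) (Real.log ν) =
      (n + 1).factorial * (σ⁻¹ ^ n * (gapSeries ν σ).coeff (n + 1)) := by
  have h := congrArg (PowerSeries.coeff (n + 1)) (rescale_taylorSeries_energy h0 h1 hσ)
  rw [PowerSeries.coeff_rescale, PowerSeries.coeff_C_mul, coeff_taylorSeries, pow_succ', mul_assoc,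
    mul_right_inj' hσ.ne'] at h
  rw [← h, inv_pow]
  field_simp

variable {w μ : ℝ} {L : ℕ}

theorem one_sub_div_mem_Ioo (hμ : 0 < μ) (hμw : μ < w) : 1 - μ / w ∈ Set.Ioo 0 1 :=
  ⟨sub_pos.2 ((div_lt_one (hμ.trans hμw)).2 hμw), sub_lt_self 1 (div_pos hμ (hμ.trans hμw))⟩

theorem criticalPoint_neg (hμ : 0 < μ) (hμw : μ < w) : criticalPoint w μ < 0 :=
  Real.log_neg (one_sub_div_mem_Ioo hμ hμw).1 (one_sub_div_mem_Ioo hμ hμw).2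

theorem topEigenvalue_exp_div (hw : 0 < w) (hL : L ≠ 0) (s : ℝ) :
    topEigenvalue w μ L (Real.exp s) / L =
      -(μ + w) + w * momentumMean (fun σ => energy (1 - μ / w) σ s) L := by
  have hsqrt : ∀ j, √(dispersion w μ (Real.exp s) (momentum L j)) =
      w * energy (1 - μ / w) (sinHalf L j) s := fun j => by
    rw [dispersion_eq hw.ne', ← sinHalf_eq, Real.sqrt_mul (sq_nonneg w), Real.sqrt_sq hw.le, energy]
  simp only [topEigenvalue, hsqrt, ← Finset.mul_sum, momentumMean]
  field_simp

theorem limitCGF_eventuallyEq (hμ : 0 < μ) (hμw : μ < w) (hL : 2 ≤ L) :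
    limitCGF w μ L =ᶠ[𝓝 (criticalPoint w μ)] fun s =>
      -(μ + w) + w * momentumMean (fun σ => energy (1 - μ / w) σ s) L := by
  filter_upwards [gt_mem_nhds (criticalPoint_neg hμ hμw)] with s hs
  rw [limitCGF_eq hμ (hμ.trans hμw) hL hs, topEigenvalue_exp_div (hμ.trans hμw) (by omega)]

theorem contDiffAt_momentumMean_energy {ν : ℝ} (h0 : 0 < ν) (h1 : ν < 1) (L : ℕ)
    (n : WithTop ℕ∞) :
    ContDiffAt ℝ n (fun s => momentumMean (fun σ => energy ν σ s) L) (Real.log ν) :=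
  (ContDiffAt.sum fun _ hj =>
    contDiffAt_energy h0 h1 (sinHalf_pos (Finset.mem_range.1 hj)) n).div_const _

theorem analyticAt_limitCGF (hμ : 0 < μ) (hμw : μ < w) (hL : 2 ≤ L) :
    AnalyticAt ℝ (limitCGF w μ L) (criticalPoint w μ) := by
  obtain ⟨h0, h1⟩ := one_sub_div_mem_Ioo hμ hμw
  exact ((contDiffAt_const.add (contDiffAt_const.mul
    (contDiffAt_momentumMean_energy h0 h1 L ⊤))).congr_of_eventuallyEq
      (limitCGF_eventuallyEq hμ hμw hL)).analyticAt

theorem iteratedDeriv_momentumMean_energy {ν : ℝ} (h0 : 0 < ν) (h1 : ν < 1) (n L : ℕ) :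
    iteratedDeriv (n + 1) (fun s => momentumMean (fun σ => energy ν σ s) L) (Real.log ν) =
      (n + 1).factorial * momentumMean (fun σ => σ⁻¹ ^ n * (gapSeries ν σ).coeff (n + 1)) L := by
  simp only [momentumMean]
  rw [iteratedDeriv_div_const, iteratedDeriv_fun_sum fun j hj =>
    contDiffAt_energy h0 h1 (sinHalf_pos (Finset.mem_range.1 hj)) _, ← mul_div_assoc,
    Finset.mul_sum]
  congr 1
  exact Finset.sum_congr rfl fun j hj =>
    iteratedDeriv_energy h0 h1 (sinHalf_pos (Finset.mem_range.1 hj)) n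

theorem criticalCumulant_succ (hμ : 0 < μ) (hμw : μ < w) (hL : 2 ≤ L) (n : ℕ) :
    criticalCumulant w μ (n + 1) L = w * (n + 1).factorial *
      momentumMean (fun σ => σ⁻¹ ^ n * (gapSeries (1 - μ / w) σ).coeff (n + 1)) L := by
  obtain ⟨h0, h1⟩ := one_sub_div_mem_Ioo hμ hμw
  rw [criticalCumulant, (limitCGF_eventuallyEq hμ hμw hL).iteratedDeriv_eq,
    iteratedDeriv_const_add n.succ_pos, iteratedDeriv_const_mul_field, criticalPoint,
    iteratedDeriv_momentumMean_energy h0 h1, mul_assoc]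

theorem tendsto_criticalCumulant_even_div (hμ : 0 < μ) (hμw : μ < w) (k : ℕ) :
    Tendsto (fun L => criticalCumulant w μ (2 * k + 2) L / invSinMean (2 * k + 1) L) atTop
      (𝓝 (w * (2 * k + 2).factorial * (gapSeries (1 - μ / w) 0).coeff (2 * k + 2))) := by
  obtain ⟨h0, h1⟩ := one_sub_div_mem_Ioo hμ hμw
  refine ((tendsto_weightedMean_div_invSinMean (p := 2 * k + 1)
    (differentiable_coeff_gapSeries h0 h1 (2 * k + 2)).continuous.continuousOn
    (by omega)).const_mul (w * (2 * k + 2).factorial)).congr' ?_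
  filter_upwards [eventually_ge_atTop 2] with L hL
  rw [criticalCumulant_succ hμ hμw hL, mul_div_assoc]

-- The odd coefficient vanishes at `σ = 0`, so one factor `σ⁻¹` turns it into a difference quotient.
theorem tendsto_criticalCumulant_odd_div (hμ : 0 < μ) (hμw : μ < w) (k : ℕ) :
    Tendsto (fun L => criticalCumulant w μ (2 * k + 3) L / invSinMean (2 * k + 1) L) atTop
      (𝓝 (w * (2 * k + 3).factorial *
        deriv (fun σ => (gapSeries (1 - μ / w) σ).coeff (2 * k + 3)) 0)) := by
  obtain ⟨h0, h1⟩ := one_sub_div_mem_Ioo hμ hμw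
  set a := fun σ => (gapSeries (1 - μ / w) σ).coeff (2 * k + 3) with ha
  have hdiff : Differentiable ℝ a := differentiable_coeff_gapSeries h0 h1 _
  have hcont : Continuous (dslope a 0) := continuous_iff_continuousAt.2 fun σ => by
    rcases eq_or_ne σ 0 with rfl | hσ
    · exact continuousAt_dslope_same.2 (hdiff 0)
    · exact (continuousAt_dslope_of_ne hσ).2 (hdiff σ).continuousAt
  have hzero : a 0 = 0 := coeff_odd_gapSeries_zero h0 h1 (k + 1)
  have h := (tendsto_weightedMean_div_invSinMean (p := 2 * k + 1) hcont.continuousOn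
    (by omega)).const_mul (w * (2 * k + 3).factorial)
  rw [dslope_same] at h
  refine h.congr' ?_
  filter_upwards [eventually_ge_atTop 2] with L hL
  rw [criticalCumulant_succ hμ hμw hL, mul_div_assoc]
  congr 2
  refine congrArg (· / (L : ℝ)) <| Finset.sum_congr rfl fun j hj => ?_
  simp only [dslope_of_ne _ (sinHalf_pos (Finset.mem_range.1 hj)).ne', slope_def_field, hzero]
  simp only [ha]
  ring

theorem tendsto_abs_atTop_of_div {f T : ℕ → ℝ} {c : ℝ} (hc : c ≠ 0)
    (h : Tendsto (fun L => f L / T L) atTop (𝓝 c)) (hT : Tendsto T atTop atTop) :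
    Tendsto (fun L => |f L|) atTop atTop := by
  refine (h.abs.pos_mul_atTop (abs_pos.2 hc) hT).congr' ?_
  filter_upwards [hT.eventually_gt_atTop 0] with L hL
  rw [abs_div, abs_of_pos hL, div_mul_cancel₀ _ hL.ne']

theorem even_limit_ne_zero (hμ : 0 < μ) (hμw : μ < w) (k : ℕ) :
    w * (2 * k + 2).factorial * (gapSeries (1 - μ / w) 0).coeff (2 * k + 2) ≠ 0 := by
  have hw := hμ.trans hμw
  obtain ⟨h0, h1⟩ := one_sub_div_mem_Ioo hμ hμw
  exact mul_ne_zero (by positivity) (coeff_even_gapSeries_zero_ne_zero h0 h1 (k + 1))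

theorem odd_limit_ne_zero (hμ : 0 < μ) (hμw : μ < w) (k : ℕ) :
    w * (2 * k + 3).factorial *
      deriv (fun σ => (gapSeries (1 - μ / w) σ).coeff (2 * k + 3)) 0 ≠ 0 := by
  have hw := hμ.trans hμw
  obtain ⟨h0, h1⟩ := one_sub_div_mem_Ioo hμ hμw
  exact mul_ne_zero (by positivity) (deriv_coeff_odd_gapSeries_zero_ne_zero h0 h1 k)

theorem tendsto_abs_criticalCumulant_even (hμ : 0 < μ) (hμw : μ < w) (k : ℕ) :
    Tendsto (fun L => |criticalCumulant w μ (2 * k + 2) L|) atTop atTop :=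
  tendsto_abs_atTop_of_div (even_limit_ne_zero hμ hμw k)
    (tendsto_criticalCumulant_even_div hμ hμw k) (tendsto_invSinMean_atTop (by omega))

theorem tendsto_abs_criticalCumulant_odd (hμ : 0 < μ) (hμw : μ < w) (k : ℕ) :
    Tendsto (fun L => |criticalCumulant w μ (2 * k + 3) L|) atTop atTop :=
  tendsto_abs_atTop_of_div (odd_limit_ne_zero hμ hμw k)
    (tendsto_criticalCumulant_odd_div hμ hμw k) (tendsto_invSinMean_atTop (by omega))

theorem isTheta_criticalCumulant_odd_even (hμ : 0 < μ) (hμw : μ < w) (k : ℕ) :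
    criticalCumulant w μ (2 * k + 3) =Θ[atTop] criticalCumulant w μ (2 * k + 2) :=
  (isTheta_of_div_tendsto_nhds_ne_zero (tendsto_criticalCumulant_odd_div hμ hμw k)
    (odd_limit_ne_zero hμ hμw k)).symm.trans
    (isTheta_of_div_tendsto_nhds_ne_zero (tendsto_criticalCumulant_even_div hμ hμw k)
      (even_limit_ne_zero hμ hμw k))

theorem kappaStarEven_eq {ν : ℝ} (h0 : 0 < ν) (h1 : ν < 1) {k : ℕ} (hk : 1 ≤ k) :
    kappaStarEven ν (k + 1) = (2 * k + 2).factorial * (gapSeries ν 0).coeff (2 * k + 2) *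
      ∑' j : ℕ, (2 / ((2 * (j : ℝ) + 1) * Real.pi)) ^ (2 * k + 1) := by
  have hν : 0 < 1 - ν ^ 2 := by nlinarith
  have hzeta : 2 * ((k + 1 : ℕ) : ℂ) - 1 = ((2 * k + 1 : ℕ) : ℂ) := by push_cast; ring
  have hrpow : (1 - ν ^ 2) ^ (((k + 1 : ℕ) : ℝ) - 1 / 2) =
      (1 - ν ^ 2) ^ (k + 1) / √(1 - ν ^ 2) := by
    rw [Real.rpow_sub hν, Real.rpow_natCast, Real.sqrt_eq_rpow]
  have hzpow : (2 : ℝ) ^ (1 - 2 * ((k + 1 : ℕ) : ℤ)) = (1 / 2) ^ (2 * k + 1) := by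
    rw [show 1 - 2 * ((k + 1 : ℕ) : ℤ) = -((2 * k + 1 : ℕ) : ℤ) by push_cast; ring,
      zpow_neg, zpow_natCast, one_div, inv_pow]
  have hsqrt : √(4 * (1 - ν ^ 2)) = 2 * √(1 - ν ^ 2) := by
    rw [Real.sqrt_mul (by norm_num), show (4 : ℝ) = 2 ^ 2 by norm_num, Real.sqrt_sq two_pos.le]
  have hfour : (4 : ℝ) ^ (k + 1) = 2 ^ (2 * k + 1) * 2 := by
    rw [← pow_succ, show 2 * k + 1 + 1 = 2 * (k + 1) by ring, pow_mul]; norm_num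
  rw [tsum_inv_odd_pow (by omega), show 2 * k + 2 = 2 * (k + 1) by ring,
    coeff_even_gapSeries_zero h0 h1, kappaStarEven, alpha, betaEven, hzeta, hrpow, hzpow, hsqrt,
    show 2 * (k + 1) - 1 = 2 * k + 1 by omega, div_pow 2 Real.pi, div_pow (ν ^ 2), mul_pow 4, hfour,
    ← pow_mul]
  field_simp

theorem tendsto_div_of_div_of_div {f g h : ℕ → ℝ} {a b : ℝ}
    (hfg : Tendsto (fun L => f L / g L) atTop (𝓝 a)) (hg : Tendsto g atTop atTop)
    (hgh : Tendsto (fun L => g L / h L) atTop (𝓝 b)) :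
    Tendsto (fun L => f L / h L) atTop (𝓝 (a * b)) := by
  refine (hfg.mul hgh).congr' ?_
  filter_upwards [hg.eventually_gt_atTop 0] with L hL
  exact div_mul_div_cancel₀ hL.ne'

theorem tendsto_zpow_mul_criticalCumulant_odd (hμ : 0 < μ) (hμw : μ < w) {n : ℕ} (hn : 3 ≤ n)
    (hodd : Odd n) :
    Tendsto (fun L : ℕ => (L : ℝ) ^ (2 - (n : ℤ)) * criticalCumulant w μ n L) atTop (𝓝 0) := by
  obtain ⟨k, rfl⟩ : ∃ k, n = 2 * k + 3 := by
    obtain ⟨m, rfl⟩ := hodd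
    exact ⟨m - 1, by omega⟩
  have h := tendsto_div_of_div_of_div (tendsto_criticalCumulant_odd_div hμ hμw k)
    (tendsto_invSinMean_atTop (by omega)) (tendsto_invSinMean_div_pow_zero (by omega))
  rw [mul_zero] at h
  refine h.congr fun L => ?_
  rw [show (2 - ((2 * k + 3 : ℕ) : ℤ)) = -((2 * k + 1 : ℕ) : ℤ) by push_cast; ring, zpow_neg,
    zpow_natCast, div_eq_inv_mul]

theorem tendsto_zpow_mul_criticalCumulant_even (hμ : 0 < μ) (hμw : μ < w) {m : ℕ} (hm : 2 ≤ m) :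
    Tendsto (fun L : ℕ => (L : ℝ) ^ (2 - ((2 * m : ℕ) : ℤ)) * criticalCumulant w μ (2 * m) L)
      atTop (𝓝 (2 * w * kappaStarEven (1 - μ / w) m)) := by
  obtain ⟨h0, h1⟩ := one_sub_div_mem_Ioo hμ hμw
  obtain ⟨k, rfl⟩ : ∃ k, m = k + 1 := ⟨m - 1, by omega⟩
  have h := tendsto_div_of_div_of_div (tendsto_criticalCumulant_even_div hμ hμw k)
    (tendsto_invSinMean_atTop (by omega)) (tendsto_invSinMean_div_pow (p := 2 * k) (by omega))
  rw [kappaStarEven_eq h0 h1 (by omega)]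
  convert h.congr fun L => ?_ using 2
  · ring
  · rw [show (2 - ((2 * (k + 1) : ℕ) : ℤ)) = -((2 * k : ℕ) : ℤ) by push_cast; ring, zpow_neg,
      zpow_natCast, div_eq_inv_mul]
    rfl

end Cumulants

end DLPAD

end

theorem mainTheorem8 (w μ : ℝ) (hμ : 0 < μ) (hμw : μ < w) :
    -- the limit defining the generating function exists, does not depend on the initial
    -- configuration in the even sector, and is analytic at the critical point
    (∀ L : ℕ, 2 ≤ L →
      (∀ s : ℝ, s < 0 → ∀ η : DLPAD.Config L, Even (DLPAD.particleNumber η) →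
        Tendsto (fun t : ℝ => DLPAD.scaledCGF w μ L η s t) atTop (𝓝 (DLPAD.limitCGF w μ L s))) ∧
      AnalyticAt ℝ (DLPAD.limitCGF w μ L) (DLPAD.criticalPoint w μ)) ∧
    -- cumulants of orders `2k` and `2k+1` diverge, at the same order in `L`
    (∀ k : ℕ, 1 ≤ k →
      Tendsto (fun L : ℕ => |DLPAD.criticalCumulant w μ (2 * k) L|) atTop atTop ∧
      Tendsto (fun L : ℕ => |DLPAD.criticalCumulant w μ (2 * k + 1) L|) atTop atTop ∧
      (fun L : ℕ => DLPAD.criticalCumulant w μ (2 * k + 1) L) =Θ[atTop]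
        (fun L : ℕ => DLPAD.criticalCumulant w μ (2 * k) L)) ∧
    -- limits of the rescaled cumulants of order `n ≥ 3`
    (∀ n : ℕ, 3 ≤ n → Odd n →
      Tendsto (fun L : ℕ => (L : ℝ) ^ (2 - (n : ℤ)) * DLPAD.criticalCumulant w μ n L)
        atTop (𝓝 0)) ∧
    (∀ n m : ℕ, 3 ≤ n → n = 2 * m →
      Tendsto (fun L : ℕ => (L : ℝ) ^ (2 - (n : ℤ)) * DLPAD.criticalCumulant w μ n L)
        atTop (𝓝 (2 * w * DLPAD.kappaStarEven (1 - μ / w) m))) := by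
  have hw := hμ.trans hμw
  refine ⟨fun L hL => ⟨fun s hs η hη => ?_, DLPAD.analyticAt_limitCGF hμ hμw hL⟩, fun k hk => ?_,
    fun n hn hodd => DLPAD.tendsto_zpow_mul_criticalCumulant_odd hμ hμw hn hodd, ?_⟩
  · rw [DLPAD.limitCGF_eq hμ hw hL hs]
    exact DLPAD.tendsto_scaledCGF hμ hw hL hs ((DLPAD.jwSign_eq_one_iff (by omega) η).2 hη)
  · obtain ⟨j, rfl⟩ : ∃ j, k = j + 1 := ⟨k - 1, by omega⟩
    exact ⟨DLPAD.tendsto_abs_criticalCumulant_even hμ hμw j,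
      DLPAD.tendsto_abs_criticalCumulant_odd hμ hμw j,
      DLPAD.isTheta_criticalCumulant_odd_even hμ hμw j⟩
  · rintro n m hn rfl
    exact DLPAD.tendsto_zpow_mul_criticalCumulant_even hμ hμw (by omega)
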